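/- Let $N\ge 4$, $\kappa>0$, $\epsilon=\pm1$. Let $\hat g=\epsilon e^{2V(x)}dy^2+e^{-2V(x)}\hat h_{ij}(x)dx^idx^j$ be an $N$-dimensional solution of the vacuum Einstein equations with vanishing cosmological constant, $R_{\mu\nu}[\hat g]=0$, where $V$ is a smooth function and $\hat h$ a smooth pseudo-Riemannian metric (of any signature) on a non-empty connected open set $\Omega\subset\mathbb R^{N-1}$. A triple $(g,\phi,W)$ is an Einstein-scalar solution if $R_{\mu\nu}[g]=\kappa\bigl(\partial_\mu\phi\,\partial_\nu\phi+\tfrac{2}{N-2}g_{\mu\nu}W(\phi)\bigr)$ and $\Box\phi=W'(\phi)$. The class $\mathcal T_N^0$ of solutions with non-vanishing potential derived from $\hat g$ consists of the Einstein-scalar solutions on $I\times\Omega$, $I\subset\mathbb R$ an open interval, of the form $$g=e^{2\mu(y)}\bigl(\epsilon e^{2\alpha V}dy^2+e^{-2\alpha V}e^{-2\delta V}\hat h_{ij}dx^idx^j\bigr),\qquad \phi=\sigma V(x)+\rho\,\mu(y),$$ with real constants $\alpha,\delta,\sigma,\rho$, a smooth non-constant function $\mu$ on $I$ and a function $W$,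 differentiable at the values of $\phi$, such that $W(\phi)$ does not vanish identically. For $\lambda\in\mathbb R$, $\eta>0$ and $\varepsilon=\pm1$ (a sign independent of $\epsilon$) put $$\alpha=\frac{\varepsilon\lambda}{\sqrt{N-3+\lambda^2}},\quad \gamma=\alpha+\frac{N-4}{N-3}(1-\alpha),\quad k=\sqrt{\frac{\kappa}{N-2}}\,\lambda,\quad W_0=-\epsilon\frac{N-2}{2\kappa}(N-1-\lambda^2)\,\eta,$$ and let $\mathcal F(\lambda,\eta,\varepsilon)$ be the metric, field and potential $$ds^2=\epsilon e^{2(\alpha V+\lambda^2\sqrt\eta Y)}dY^2+e^{-2\gamma V+2\sqrt\eta Y}\hat h_{ij}dx^idx^j,$$ $$\phi=\sqrt{\frac{N-2}{\kappa}}\left(\frac{\varepsilon V}{\sqrt{N-3+\lambda^2}}+\lambda\sqrt\eta\,Y\right),\qquad W(\phi)=W_0e^{-2k\phi}.$$ (1) Each $\mathcal F(\lambda,\eta,\varepsilon)$ is an Einstein-scalar solution on $\mathbb R\times\Omega$; $W_0\neq0$ if and only if $\lambda^2\neq N-1$; and in that case it is, after a smooth change of coordinate $Y=Y(y)$ from an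 open interval onto $\mathbb R$, in the above class, with this $\alpha$ and with $\delta=\frac{N-4}{N-3}(1-\alpha)$. (2) Conversely, consider any solution of the class for which one of the following holds: (a) $V\equiv0$; (b) $V$ is not exceptional, where exceptional means that $\nabla_i\nabla_jV=a\,\partial_iV\partial_jV+b\,\hat h_{ij}$ on $\Omega$ for some constant $a$ and function $b$, $\nabla$ being the Levi-Civita connection of $\hat h$; (c) $V$ is not constant and $\delta=\frac{N-4}{N-3}(1-\alpha)$. Then there is exactly one pair $(\lambda,\eta)$ with $\eta>0$, $\lambda^2\ne N-1$ such that the solution is, for some sign $\varepsilon$ and after some smooth invertible change of coordinate $Y=Y(y)$ on $I$, the solution $\mathcal F(\lambda,\eta,\varepsilon)$, where the potentials are compared at the values of $\phi$. So these solutions form a two-parameter family with parameters $\lambda$ and $\eta$. -/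

import Mathlib

open scoped ContDiff

namespace Fonarev

noncomputable section

/-! ### Pseudo-Riemannian geometry in coordinates -/

/-- Partial derivative of `f` in the `i`-th coordinate direction. -/
def pd {m : ℕ} (i : Fin m) (f : (Fin m → ℝ) → ℝ) (p : Fin m → ℝ) : ℝ :=
  fderiv ℝ f p (Pi.single i 1)

/-- `g` is a smooth pseudo-Riemannian metric (of any signature) on the open set `D`, given by its
components in the standard coordinates. -/
structure IsMetricOn {m : ℕ} (D : Set (Fin m → ℝ))
    (g : (Fin m → ℝ) → Matrix (Fin m) (Fin m) ℝ) : Prop where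
  smooth : ∀ i j, ContDiffOn ℝ ∞ (fun p => g p i j) D
  symm : ∀ p ∈ D, (g p).IsSymm
  nondegenerate : ∀ p ∈ D, (g p).det ≠ 0

/-- Christoffel symbols `Γ^k_{ij}` of the metric `g`. -/
def christoffel {m : ℕ} (g : (Fin m → ℝ) → Matrix (Fin m) (Fin m) ℝ) (k i j : Fin m)
    (p : Fin m → ℝ) : ℝ :=
  (1 / 2) * ∑ l, (g p)⁻¹ k l *
    (pd i (fun q => g q l j) p + pd j (fun q => g q l i) p - pd l (fun q => g q i j) p)

/-- The Ricci tensor `R_{ij}` of the metric `g`; the sign is the one for which round spheres have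
positive Ricci curvature. -/
def ricci {m : ℕ} (g : (Fin m → ℝ) → Matrix (Fin m) (Fin m) ℝ) (i j : Fin m)
    (p : Fin m → ℝ) : ℝ :=
  ∑ k, (pd k (christoffel g k i j) p - pd j (christoffel g k i k) p
    + ∑ l, (christoffel g k k l p * christoffel g l i j p
      - christoffel g k j l p * christoffel g l i k p))

/-- The covariant Hessian `∇_i ∇_j f` with respect to the metric `g`. -/
def hessian {m : ℕ} (g : (Fin m → ℝ) → Matrix (Fin m) (Fin m) ℝ) (f : (Fin m → ℝ) → ℝ)
    (i j : Fin m) (p : Fin m → ℝ) : ℝ :=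
  pd i (pd j f) p - ∑ k, christoffel g k i j p * pd k f p

/-- The operator `□ f = g^{ij} ∇_i ∇_j f`. -/
def box {m : ℕ} (g : (Fin m → ℝ) → Matrix (Fin m) (Fin m) ℝ) (f : (Fin m → ℝ) → ℝ)
    (p : Fin m → ℝ) : ℝ :=
  ∑ i, ∑ j, (g p)⁻¹ i j * hessian g f i j p

/-- Pullback of the symmetric 2-tensor `g` along the map `F`. -/
def pullback {m : ℕ} (F : (Fin m → ℝ) → (Fin m → ℝ))
    (g : (Fin m → ℝ) → Matrix (Fin m) (Fin m) ℝ) (p : Fin m → ℝ) :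
    Matrix (Fin m) (Fin m) ℝ :=
  Matrix.of fun a b =>
    ∑ c, ∑ d, pd a (fun q => F q c) p * pd b (fun q => F q d) p * g (F p) c d

/-! ### Field equations -/

/-- `(g, φ)` solves on `D` the minimally coupled Einstein-scalar field equations in dimension `m`
with gravitational coupling `κ` and scalar potential `W`:
`R_{ij} = κ (∂_i φ ∂_j φ + 2/(m-2) g_{ij} W(φ))` and `□ φ = W'(φ)`. -/
structure IsEinsteinScalarSolution {m : ℕ} (κ : ℝ) (D : Set (Fin m → ℝ))
    (g : (Fin m → ℝ) → Matrix (Fin m) (Fin m) ℝ) (φ : (Fin m → ℝ) → ℝ) (W : ℝ → ℝ) :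
    Prop where
  metric : IsMetricOn D g
  smooth_field : ContDiffOn ℝ ∞ φ D
  differentiable_potential : ∀ p ∈ D, DifferentiableAt ℝ W (φ p)
  einstein : ∀ p ∈ D, ∀ i j,
    ricci g i j p = κ * (pd i φ p * pd j φ p + 2 / ((m : ℝ) - 2) * g p i j * W (φ p))
  scalar : ∀ p ∈ D, box g φ p = deriv W (φ p)

/-! ### Orthogonal-symmetric metrics

Points of the `(n+1)`-dimensional space are `p = (y, x)` with `y = p 0` and `x = Fin.tail p`. -/

/-- The cylinder `I × Ω` of points `(y, x)` with `y ∈ I` and `x ∈ Ω`. -/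
def cylinder {n : ℕ} (I : Set ℝ) (Ω : Set (Fin n → ℝ)) : Set (Fin (n + 1) → ℝ) :=
  {p | p 0 ∈ I ∧ Fin.tail p ∈ Ω}

/-- The matrix `diag(a, B)` of the line element `a dy² + B_{ij} dx^i dx^j`. -/
def blockMatrix {n : ℕ} (a : ℝ) (B : Matrix (Fin n) (Fin n) ℝ) :
    Matrix (Fin (n + 1)) (Fin (n + 1)) ℝ :=
  Matrix.of (Fin.cons (Fin.cons a fun _ => 0) fun i => Fin.cons 0 (B i))

/-- The metric `g[U, h] = ε e^{2U(x)} dy² + e^{-2U(x)} h_{ij}(x) dx^i dx^j`. -/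
def orthSymMetric {n : ℕ} (ε : ℝ) (U : (Fin n → ℝ) → ℝ)
    (h : (Fin n → ℝ) → Matrix (Fin n) (Fin n) ℝ) (p : Fin (n + 1) → ℝ) :
    Matrix (Fin (n + 1)) (Fin (n + 1)) ℝ :=
  blockMatrix (ε * Real.exp (2 * U (Fin.tail p)))
    (Real.exp (-2 * U (Fin.tail p)) • h (Fin.tail p))

/-- `g[V, h]` is an orthogonal-symmetric solution of the vacuum Einstein equations with
vanishing cosmological constant, over the domain `Ω` of the coordinates `x`. -/
structure IsVacuumSeed {n : ℕ} (ε : ℝ) (Ω : Set (Fin n → ℝ)) (V : (Fin n → ℝ) → ℝ)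
    (h : (Fin n → ℝ) → Matrix (Fin n) (Fin n) ℝ) : Prop where
  smooth : ContDiffOn ℝ ∞ V Ω
  metric : IsMetricOn Ω h
  vacuum : ∀ p ∈ cylinder Set.univ Ω, ∀ i j, ricci (orthSymMetric ε V h) i j p = 0

/-- `V` is exceptional: `∇∇V = a dV ⊗ dV + b h` with a constant `a` and a function `b`. -/
def IsExceptional {n : ℕ} (Ω : Set (Fin n → ℝ)) (V : (Fin n → ℝ) → ℝ)
    (h : (Fin n → ℝ) → Matrix (Fin n) (Fin n) ℝ) : Prop :=
  ∃ (a : ℝ) (b : (Fin n → ℝ) → ℝ), ∀ x ∈ Ω, ∀ i j,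
    hessian h V i j x = a * pd i V x * pd j V x + b x * h x i j

/-! ### The solution class -/

/-- The conformally `y`-inflated metric
`e^{2μ(y)} (ε e^{2αV} dy² + e^{-2αV} h_{ij} dx^i dx^j)` with `ĥ = e^{2δV} h`. -/
def inflatedMetric {n : ℕ} (ε : ℝ) (V : (Fin n → ℝ) → ℝ)
    (hhat : (Fin n → ℝ) → Matrix (Fin n) (Fin n) ℝ) (α δ : ℝ) (μ : ℝ → ℝ)
    (p : Fin (n + 1) → ℝ) : Matrix (Fin (n + 1)) (Fin (n + 1)) ℝ :=
  Real.exp (2 * μ (p 0)) •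
    orthSymMetric ε (fun x => α * V x) (fun x => Real.exp (-2 * (δ * V x)) • hhat x) p

/-- The scalar field `φ = σ V(x) + ρ μ(y)`. -/
def inflatedField {n : ℕ} (V : (Fin n → ℝ) → ℝ) (σ ρ : ℝ) (μ : ℝ → ℝ)
    (p : Fin (n + 1) → ℝ) : ℝ :=
  σ * V (Fin.tail p) + ρ * μ (p 0)

/-- The data `(I, μ, α, δ, σ, ρ, W)` define a conformally `y`-inflated (`μ` not constant)
Einstein-scalar solution on `I × Ω`, derived from the seed `g[V, ĥ]`, with a scalar potential
that does not vanish identically on the solution. -/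
structure IsInflatedSolution {n : ℕ} (κ ε : ℝ) (Ω : Set (Fin n → ℝ)) (V : (Fin n → ℝ) → ℝ)
    (hhat : (Fin n → ℝ) → Matrix (Fin n) (Fin n) ℝ) (I : Set ℝ) (μ : ℝ → ℝ)
    (α δ σ ρ : ℝ) (W : ℝ → ℝ) : Prop where
  isOpen : IsOpen I
  interval : I.OrdConnected
  smooth : ContDiffOn ℝ ∞ μ I
  nonconstant : ¬ ∃ c, ∀ y ∈ I, μ y = c
  solution : IsEinsteinScalarSolution κ (cylinder I Ω) (inflatedMetric ε V hhat α δ μ)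
    (inflatedField V σ ρ μ) W
  potential : ∃ p ∈ cylinder I Ω, W (inflatedField V σ ρ μ p) ≠ 0

/-! ### The generalized Fonarev family -/

/-- `α = s λ / √(N - 3 + λ²)`, where `s = ±1`. -/
def alpha (N : ℕ) (lam s : ℝ) : ℝ := s * lam / √((N : ℝ) - 3 + lam ^ 2)

/-- `δ = (N - 4)/(N - 3) (1 - α)`. -/
def delta (N : ℕ) (α : ℝ) : ℝ := ((N : ℝ) - 4) / ((N : ℝ) - 3) * (1 - α)

/-- `γ = α + (N - 4)/(N - 3) (1 - α)`. -/
def gamma (N : ℕ) (lam s : ℝ) : ℝ := alpha N lam s + delta N (alpha N lam s)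

/-- The metric `ε e^{2(αV + λ²√η Y)} dY² + e^{-2γV + 2√η Y} ĥ_{ij} dx^i dx^j`. -/
def fonarevMetric {n : ℕ} (N : ℕ) (ε : ℝ) (V : (Fin n → ℝ) → ℝ)
    (hhat : (Fin n → ℝ) → Matrix (Fin n) (Fin n) ℝ) (lam η s : ℝ)
    (p : Fin (n + 1) → ℝ) : Matrix (Fin (n + 1)) (Fin (n + 1)) ℝ :=
  blockMatrix
    (ε * Real.exp (2 * (alpha N lam s * V (Fin.tail p) + lam ^ 2 * √η * p 0)))
    (Real.exp (-2 * gamma N lam s * V (Fin.tail p) + 2 * √η * p 0) • hhat (Fin.tail p))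

/-- The field `φ = √((N-2)/κ) (s V / √(N-3+λ²) + λ √η Y)`. -/
def fonarevField {n : ℕ} (N : ℕ) (κ : ℝ) (V : (Fin n → ℝ) → ℝ) (lam η s : ℝ)
    (p : Fin (n + 1) → ℝ) : ℝ :=
  √(((N : ℝ) - 2) / κ) *
    (s * (1 / √((N : ℝ) - 3 + lam ^ 2)) * V (Fin.tail p) + lam * √η * p 0)

/-- `W₀ = -ε (N-2)/(2κ) (N-1-λ²) η`. -/
def fonarevW0 (N : ℕ) (κ ε lam η : ℝ) : ℝ :=
  -ε * (((N : ℝ) - 2) / (2 * κ)) * ((N : ℝ) - 1 - lam ^ 2) * η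

/-- The potential `W(φ) = W₀ e^{-2kφ}` with `k = √(κ/(N-2)) λ`. -/
def fonarevPotential (N : ℕ) (κ ε lam η : ℝ) (t : ℝ) : ℝ :=
  fonarevW0 N κ ε lam η * Real.exp (-2 * (√(κ / ((N : ℝ) - 2)) * lam) * t)

/-- The map `(y, x) ↦ (Y(y), x)`. -/
def changeY {n : ℕ} (Y : ℝ → ℝ) (p : Fin (n + 1) → ℝ) : Fin (n + 1) → ℝ :=
  Fin.cons (Y (p 0)) (Fin.tail p)

/-- `Y` is a smooth change of coordinate on `I`, with smooth inverse. -/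
structure IsCoordChange (I : Set ℝ) (Y : ℝ → ℝ) : Prop where
  smooth : ContDiffOn ℝ ∞ Y I
  deriv_ne_zero : ∀ y ∈ I, deriv Y y ≠ 0
  injective : Set.InjOn Y I

/-- After the change of coordinate `Y = Y(y)`, the fields `(g, φ, W)` on `I × Ω` are the member
of the generalized Fonarev family with parameters `λ`, `η` and sign `s`. -/
structure IsFonarevIn {n : ℕ} (N : ℕ) (κ ε : ℝ) (Ω : Set (Fin n → ℝ)) (V : (Fin n → ℝ) → ℝ)
    (hhat : (Fin n → ℝ) → Matrix (Fin n) (Fin n) ℝ) (I : Set ℝ)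
    (g : (Fin (n + 1) → ℝ) → Matrix (Fin (n + 1)) (Fin (n + 1)) ℝ)
    (φ : (Fin (n + 1) → ℝ) → ℝ) (W : ℝ → ℝ) (lam η s : ℝ) (Y : ℝ → ℝ) : Prop where
  coordChange : IsCoordChange I Y
  metric : ∀ p ∈ cylinder I Ω,
    g p = pullback (changeY Y) (fonarevMetric N ε V hhat lam η s) p
  field : ∀ p ∈ cylinder I Ω, φ p = fonarevField N κ V lam η s (changeY Y p)
  potential : ∀ p ∈ cylinder I Ω, W (φ p) = fonarevPotential N κ ε lam η (φ p)

end

end Fonarev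

/-! Put n = N - 1. Three metrics occur, and all are cases of `warpMetric`, ε e^{2(r(y)+αV)} dy² +
e^{2(q(y)-βV)} ĥ. The seed has r = q = 0 and α = β = 1; the class has r = q = μ and β = α + δ; the
Fonarev metric has r = λ²√η y, q = √η y and β = γ. One computation of the Ricci tensor and of □ for
a warped metric (`IsWarpData.ricci_zero_zero`, `ricci_zero_succ`, `ricci_succ_succ`,
`box_warpMetric`) therefore yields every field equation. For the seed it gives □V = (n-3)|∇V|² and
Ric(ĥ) = -(n-3)∇∇V - (n-5) dV⊗dV.

After substituting these, the spatial Einstein equations read c ∇∇V + t dV⊗dV = f ĥ with constants c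
= (n-2)β - α - (n-3) and t. The constant c also multiplies the |∇V|² terms of the yy equation and of
the scalar equation. The Fonarev exponents are those with c = t = 0 that also satisfy the mixed
equation (n-1)α = κρσ. What remains is an ODE of Friedmann type in y, which holds both in the
coordinate Y and in the coordinate where r = q (`IsVacuumSeed.isEinsteinScalarSolution`).

Conversely, if c ≠ 0, division by c shows that V is exceptional. So c = 0, unless V ≡ 0, when its
terms vanish anyway. Then t dV⊗dV = f ĥ, and a nondegenerate form in dimension n ≥ 3 is not of rank
one, so f = 0; also t = 0 if V is not constant. The equation f = 0 gives W, and with it the yy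
equation becomes μ'' = (1-λ²)μ'² with λ = ρ√(κ/(N-2)). The equations t = 0 and (n-1)α = κρσ fix α
and σ up to a sign (`IsInflatedSolution.friedmann`). Integration gives μ' = C e^{(1-λ²)μ}, and Y =
μ/√η with η = C² is the required coordinate.

For uniqueness, the metric forces √η Y = μ, the field then fixes λ, and the dy² term fixes η = μ'²
e^{-2(1-λ²)μ} (`IsInflatedSolution.parameters_eq`). -/

namespace Fonarev

/-! ### Calculus of partial derivatives, also on a cylinder -/

section

/-- `f` is differentiable at `p`, and its `i`-th partial derivative there is `f'`. -/
def HasPD {m : ℕ} (i : Fin m) (f : (Fin m → ℝ) → ℝ) (f' : ℝ) (p : Fin m → ℝ) : Prop :=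
  DifferentiableAt ℝ f p ∧ pd i f p = f'

namespace HasPD

variable {m : ℕ} {i : Fin m} {f g : (Fin m → ℝ) → ℝ} {f' g' : ℝ} {p : Fin m → ℝ}

theorem of_differentiableAt (hf : DifferentiableAt ℝ f p) : HasPD i f (pd i f p) p := ⟨hf, rfl⟩

theorem congr_value (hf : HasPD i f f' p) (h : f' = g') : HasPD i f g' p := h ▸ hf

/-- Formulas for Christoffel symbols hold only on an open set; this is what allows them to be
differentiated there. -/
theorem congr_fun (hf : HasPD i f f' p) (h : g =ᶠ[nhds p] f) : HasPD i g f' p :=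
  ⟨hf.1.congr_of_eventuallyEq h, by rw [← hf.2, pd, pd, h.fderiv_eq]⟩

theorem const (c : ℝ) : HasPD i (fun _ => c) 0 p :=
  ⟨differentiableAt_const c, by simp [pd]⟩

theorem add (hf : HasPD i f f' p) (hg : HasPD i g g' p) :
    HasPD i (fun q => f q + g q) (f' + g') p :=
  ⟨hf.1.add hg.1, by rw [← hf.2, ← hg.2, pd, fderiv_fun_add hf.1 hg.1]; rfl⟩

theorem sub (hf : HasPD i f f' p) (hg : HasPD i g g' p) :
    HasPD i (fun q => f q - g q) (f' - g') p :=
  ⟨hf.1.sub hg.1, by rw [← hf.2, ← hg.2, pd, fderiv_fun_sub hf.1 hg.1]; rfl⟩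

theorem mul (hf : HasPD i f f' p) (hg : HasPD i g g' p) :
    HasPD i (fun q => f q * g q) (f' * g p + f p * g') p :=
  ⟨hf.1.mul hg.1, by
    rw [← hf.2, ← hg.2, pd, fderiv_fun_mul hf.1 hg.1]
    simp [pd]; ring⟩

theorem const_mul (c : ℝ) (hf : HasPD i f f' p) : HasPD i (fun q => c * f q) (c * f') p :=
  ((const c).mul hf).congr_value (by ring)

theorem neg (hf : HasPD i f f' p) : HasPD i (fun q => -f q) (-f') p :=
  ⟨hf.1.neg, by rw [← hf.2, pd, fderiv_fun_neg]; rfl⟩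

theorem exp (hf : HasPD i f f' p) : HasPD i (fun q => Real.exp (f q)) (Real.exp (f p) * f') p :=
  ⟨hf.1.exp, by rw [← hf.2, pd, fderiv_exp hf.1]; simp [pd]⟩

theorem sum {ι : Type*} {s : Finset ι} {F : ι → (Fin m → ℝ) → ℝ} {F' : ι → ℝ}
    (h : ∀ a ∈ s, HasPD i (F a) (F' a) p) :
    HasPD i (fun q => ∑ a ∈ s, F a q) (∑ a ∈ s, F' a) p :=
  ⟨DifferentiableAt.fun_sum fun a ha => (h a ha).1, by
    rw [pd, fderiv_fun_sum fun a ha => (h a ha).1, _root_.sum_apply]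
    exact Finset.sum_congr rfl fun a ha => (h a ha).2⟩

end HasPD

section Cylinder

variable {n : ℕ} {p : Fin (n + 1) → ℝ}

theorem hasFDerivAt_zero {f : ℝ → ℝ} {f' : ℝ} (hf : HasDerivAt f f' (p 0)) :
    HasFDerivAt (fun q : Fin (n + 1) → ℝ => f (q 0))
      (f' • ContinuousLinearMap.proj (R := ℝ) (φ := fun _ : Fin (n + 1) => ℝ) 0) p :=
  hf.comp_hasFDerivAt p (hasFDerivAt_apply (𝕜 := ℝ) (0 : Fin (n + 1)) p)

theorem HasPD.zero_zero {f : ℝ → ℝ} {f' : ℝ} (hf : HasDerivAt f f' (p 0)) :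
    HasPD 0 (fun q : Fin (n + 1) → ℝ => f (q 0)) f' p :=
  ⟨(hasFDerivAt_zero hf).differentiableAt, by
    rw [pd, (hasFDerivAt_zero hf).fderiv]; simp⟩

theorem HasPD.succ_zero {f : ℝ → ℝ} {f' : ℝ} (hf : HasDerivAt f f' (p 0)) (i : Fin n) :
    HasPD i.succ (fun q : Fin (n + 1) → ℝ => f (q 0)) 0 p :=
  ⟨(hasFDerivAt_zero hf).differentiableAt, by
    rw [pd, (hasFDerivAt_zero hf).fderiv]; simp⟩

/-- The projection `(y, x) ↦ x` as a continuous linear map. -/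
noncomputable def tailL (n : ℕ) : (Fin (n + 1) → ℝ) →L[ℝ] (Fin n → ℝ) :=
  ContinuousLinearMap.pi fun i => ContinuousLinearMap.proj i.succ

theorem hasFDerivAt_tail {f : (Fin n → ℝ) → ℝ} (hf : DifferentiableAt ℝ f (Fin.tail p)) :
    HasFDerivAt (fun q : Fin (n + 1) → ℝ => f (Fin.tail q))
      ((fderiv ℝ f (Fin.tail p)).comp (tailL n)) p :=
  HasFDerivAt.comp (f := fun q : Fin (n + 1) → ℝ => Fin.tail q) p hf.hasFDerivAt
    (tailL n).hasFDerivAt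

theorem HasPD.zero_tail {f : (Fin n → ℝ) → ℝ} (hf : DifferentiableAt ℝ f (Fin.tail p)) :
    HasPD 0 (fun q : Fin (n + 1) → ℝ => f (Fin.tail q)) 0 p :=
  ⟨(hasFDerivAt_tail hf).differentiableAt, by
    have h0 : tailL n (Pi.single 0 1) = 0 := by ext j; simp [tailL]
    rw [pd, (hasFDerivAt_tail hf).fderiv, ContinuousLinearMap.comp_apply, h0, map_zero]⟩

theorem HasPD.succ_tail {f : (Fin n → ℝ) → ℝ} {f' : ℝ} {i : Fin n}
    (hf : HasPD i f f' (Fin.tail p)) :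
    HasPD i.succ (fun q : Fin (n + 1) → ℝ => f (Fin.tail q)) f' p :=
  ⟨(hasFDerivAt_tail hf.1).differentiableAt, by
    have h0 : tailL n (Pi.single i.succ 1) = Pi.single i 1 := by
      ext j; simp [tailL, Pi.single_apply]
    rw [pd, (hasFDerivAt_tail hf.1).fderiv, ContinuousLinearMap.comp_apply, h0]
    exact hf.2⟩

theorem isOpen_cylinder {I : Set ℝ} {Ω : Set (Fin n → ℝ)} (hI : IsOpen I) (hΩ : IsOpen Ω) :
    IsOpen (cylinder I Ω) :=
  (hI.preimage (continuous_apply 0)).inter (hΩ.preimage (tailL n).continuous)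

theorem contDiff_tail : ContDiff ℝ ∞ (fun q : Fin (n + 1) → ℝ => Fin.tail q) :=
  (tailL n).contDiff

theorem contDiffOn_comp_tail {f : (Fin n → ℝ) → ℝ} {I : Set ℝ} {Ω : Set (Fin n → ℝ)}
    (hf : ContDiffOn ℝ ∞ f Ω) :
    ContDiffOn ℝ ∞ (fun q : Fin (n + 1) → ℝ => f (Fin.tail q)) (cylinder I Ω) :=
  hf.comp contDiff_tail.contDiffOn fun _ h => h.2

theorem contDiffOn_comp_zero {f : ℝ → ℝ} {I : Set ℝ} {Ω : Set (Fin n → ℝ)}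
    (hf : ContDiffOn ℝ ∞ f I) :
    ContDiffOn ℝ ∞ (fun q : Fin (n + 1) → ℝ => f (q 0)) (cylinder I Ω) :=
  hf.comp (contDiff_apply ℝ ℝ (0 : Fin (n + 1))).contDiffOn fun _ h => h.1

end Cylinder

/-! ### Levi-Civita connection, gradient and Hessian in coordinates -/

section Geometry

variable {m : ℕ} {D : Set (Fin m → ℝ)} {g : (Fin m → ℝ) → Matrix (Fin m) (Fin m) ℝ}
  {V : (Fin m → ℝ) → ℝ} {x : Fin m → ℝ}

theorem differentiableAt_of_contDiffOn (hD : IsOpen D) (hV : ContDiffOn ℝ ∞ V D) (hx : x ∈ D) :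
    DifferentiableAt ℝ V x :=
  ((hV x hx).contDiffAt (hD.mem_nhds hx)).differentiableAt (by simp)

theorem contDiffOn_pd (hD : IsOpen D) (hV : ContDiffOn ℝ ∞ V D) (i : Fin m) :
    ContDiffOn ℝ ∞ (pd i V) D :=
  (hV.fderiv_of_isOpen hD (by simp)).clm_apply contDiffOn_const

theorem pd_pd_comm (hD : IsOpen D) (hV : ContDiffOn ℝ ∞ V D) (hx : x ∈ D) (i j : Fin m) :
    pd i (pd j V) x = pd j (pd i V) x := by
  have hs := ((hV x hx).contDiffAt (hD.mem_nhds hx)).isSymmSndFDerivAt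
    (by rw [minSmoothness_of_isRCLikeNormedField]; exact WithTop.coe_le_coe.2 le_top)
  have hd : DifferentiableAt ℝ (fderiv ℝ V) x :=
    (((hV.fderiv_of_isOpen (m := ∞) hD (by simp)) x hx).contDiffAt
      (hD.mem_nhds hx)).differentiableAt (by simp)
  -- Both iterated partial derivatives are values of the second Fréchet derivative on basis vectors,
  -- which is symmetric.
  have key : ∀ a b : Fin m, pd a (pd b V) x =
      fderiv ℝ (fderiv ℝ V) x (Pi.single a 1) (Pi.single b 1) := by
    intro a b
    have : pd b V = fun q => fderiv ℝ V q (Pi.single b 1) := rfl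
    rw [pd, this, fderiv_clm_apply hd (differentiableAt_const _)]
    simp
  rw [key, key]
  exact hs _ _

theorem contDiffOn_det {ι : Type*} [Fintype ι] [DecidableEq ι]
    {A : (Fin m → ℝ) → Matrix ι ι ℝ} (hA : ∀ i j, ContDiffOn ℝ ∞ (fun q => A q i j) D) :
    ContDiffOn ℝ ∞ (fun q => (A q).det) D := by
  simp only [Matrix.det_apply']
  exact ContDiffOn.sum fun σ _ => contDiffOn_const.mul (contDiffOn_prod fun i _ => hA _ _)

/-- Cramer's rule: the entries are determinants in the smooth entries of `g`, divided by the
nonvanishing `det g`. -/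
theorem IsMetricOn.contDiffOn_inv (hg : IsMetricOn D g) (i j : Fin m) :
    ContDiffOn ℝ ∞ (fun q => (g q)⁻¹ i j) D := by
  simp only [Matrix.inv_def, Matrix.smul_apply, Ring.inverse_eq_inv', smul_eq_mul,
    Matrix.adjugate_apply]
  refine ((contDiffOn_det hg.smooth).inv hg.nondegenerate).mul (contDiffOn_det fun a b => ?_)
  simp only [Matrix.updateRow_apply]
  split_ifs
  · exact contDiffOn_const
  · exact hg.smooth a b

theorem IsMetricOn.contDiffOn_christoffel (hD : IsOpen D) (hg : IsMetricOn D g) (k i j : Fin m) :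
    ContDiffOn ℝ ∞ (christoffel g k i j) D :=
  contDiffOn_const.mul <| ContDiffOn.sum fun l _ => (hg.contDiffOn_inv k l).mul <|
    ((contDiffOn_pd hD (hg.smooth l j) i).add (contDiffOn_pd hD (hg.smooth l i) j)).sub
      (contDiffOn_pd hD (hg.smooth i j) l)

theorem IsMetricOn.apply_comm (hg : IsMetricOn D g) (hx : x ∈ D) (i j : Fin m) :
    g x i j = g x j i := (hg.symm x hx).apply j i

theorem IsMetricOn.pd_comm (hD : IsOpen D) (hg : IsMetricOn D g) (hx : x ∈ D) (k i j : Fin m) :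
    pd k (fun q => g q i j) x = pd k (fun q => g q j i) x := by
  have : (fun q => g q i j) =ᶠ[nhds x] fun q => g q j i := by
    filter_upwards [hD.mem_nhds hx] with q hq using hg.apply_comm hq i j
  rw [pd, pd, this.fderiv_eq]

theorem IsMetricOn.christoffel_comm (hD : IsOpen D) (hg : IsMetricOn D g) (hx : x ∈ D)
    (k i j : Fin m) : christoffel g k i j x = christoffel g k j i x := by
  rw [christoffel, christoffel]
  congr 1
  refine Finset.sum_congr rfl fun l _ => ?_
  rw [hg.pd_comm hD hx l i j]
  ring

theorem IsMetricOn.sum_mul_inv (hg : IsMetricOn D g) (hx : x ∈ D) (i j : Fin m) :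
    ∑ k, g x i k * (g x)⁻¹ k j = if i = j then 1 else 0 := by
  rw [← Matrix.mul_apply, Matrix.mul_nonsing_inv _ (isUnit_iff_ne_zero.2 (hg.nondegenerate x hx)),
    Matrix.one_apply]

theorem IsMetricOn.sum_inv_mul (hg : IsMetricOn D g) (hx : x ∈ D) (i j : Fin m) :
    ∑ k, (g x)⁻¹ i k * g x k j = if i = j then 1 else 0 := by
  rw [← Matrix.mul_apply, Matrix.nonsing_inv_mul _ (isUnit_iff_ne_zero.2 (hg.nondegenerate x hx)),
    Matrix.one_apply]

/-- Contracting the metric with its inverse and a covector returns the covector. -/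
theorem IsMetricOn.sum_mul_sum_inv (hg : IsMetricOn D g) (hx : x ∈ D) (v : Fin m → ℝ) (i : Fin m) :
    ∑ k, g x i k * ∑ l, (g x)⁻¹ k l * v l = v i := by
  simp only [Finset.mul_sum, ← mul_assoc]
  rw [Finset.sum_comm]
  simp only [← Finset.sum_mul, hg.sum_mul_inv hx]
  simp

theorem IsMetricOn.sum_inv_sum_mul (hg : IsMetricOn D g) (hx : x ∈ D) (v : Fin m → ℝ) (i : Fin m) :
    ∑ k, (g x)⁻¹ i k * ∑ l, g x k l * v l = v i := by
  simp only [Finset.mul_sum, ← mul_assoc]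
  rw [Finset.sum_comm]
  simp only [← Finset.sum_mul, hg.sum_inv_mul hx]
  simp

/-- Lowering the upper index cancels the inverse metric and leaves the Christoffel symbols of the
first kind. -/
theorem IsMetricOn.sum_mul_christoffel (hg : IsMetricOn D g) (hx : x ∈ D) (l i j : Fin m) :
    ∑ k, g x l k * christoffel g k i j x = (1 / 2) *
      (pd i (fun q => g q l j) x + pd j (fun q => g q l i) x - pd l (fun q => g q i j) x) := by
  rw [← hg.sum_mul_sum_inv hx
    (fun l => (1 / 2) * (pd i (fun q => g q l j) x + pd j (fun q => g q l i) x
      - pd l (fun q => g q i j) x)) l]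
  refine Finset.sum_congr rfl fun k _ => ?_
  rw [christoffel, Finset.mul_sum]
  congr 1
  exact Finset.sum_congr rfl fun _ _ => by ring

/-- The Levi-Civita connection is compatible with the metric. -/
theorem IsMetricOn.pd_eq (hD : IsOpen D) (hg : IsMetricOn D g) (hx : x ∈ D) (k i j : Fin m) :
    pd k (fun q => g q i j) x =
      ∑ l, g x i l * christoffel g l k j x + ∑ l, g x j l * christoffel g l k i x := by
  rw [hg.sum_mul_christoffel hx, hg.sum_mul_christoffel hx, hg.pd_comm hD hx k j i,
    hg.pd_comm hD hx j k i, hg.pd_comm hD hx i j k]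
  ring

/-- The gradient `g^{kl} ∂_l V`. -/
noncomputable def grad (g : (Fin m → ℝ) → Matrix (Fin m) (Fin m) ℝ) (V : (Fin m → ℝ) → ℝ)
    (k : Fin m) (x : Fin m → ℝ) : ℝ := ∑ l, (g x)⁻¹ k l * pd l V x

theorem contDiffOn_grad (hD : IsOpen D) (hg : IsMetricOn D g) (hV : ContDiffOn ℝ ∞ V D)
    (k : Fin m) : ContDiffOn ℝ ∞ (grad g V k) D :=
  ContDiffOn.sum fun l _ => (hg.contDiffOn_inv k l).mul (contDiffOn_pd hD hV l)

theorem sum_mul_grad (hg : IsMetricOn D g) (hx : x ∈ D) (i : Fin m) :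
    ∑ k, g x i k * grad g V k x = pd i V x :=
  hg.sum_mul_sum_inv hx (fun l => pd l V x) i

/-- `∂_j (grad V)^k = g^{kl} ∇_j ∇_l V - Γ^k_{jl} (grad V)^l`. -/
theorem pd_grad (hD : IsOpen D) (hg : IsMetricOn D g) (hV : ContDiffOn ℝ ∞ V D) (hx : x ∈ D)
    (j k : Fin m) : pd j (grad g V k) x =
      ∑ l, (g x)⁻¹ k l * hessian g V j l x - ∑ l, christoffel g k j l x * grad g V l x := by
  -- Differentiate g_{ik} (grad V)^k = ∂_i V and replace ∂g by Christoffel symbols. The index i is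
  -- raised afterwards.
  have hlow : ∀ i, ∑ k, g x i k * pd j (grad g V k) x =
      hessian g V j i x - ∑ k, g x i k * ∑ l, christoffel g k j l x * grad g V l x := by
    intro i
    have h1 : HasPD j (fun q => ∑ k, g q i k * grad g V k q)
        (∑ k, (pd j (fun q => g q i k) x * grad g V k x + g x i k * pd j (grad g V k) x)) x :=
      HasPD.sum fun k _ =>
        (HasPD.of_differentiableAt (differentiableAt_of_contDiffOn hD (hg.smooth i k) hx)).mul
          (HasPD.of_differentiableAt
            (differentiableAt_of_contDiffOn hD (contDiffOn_grad hD hg hV k) hx))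
    have h2 : HasPD j (fun q => ∑ k, g q i k * grad g V k q) (pd j (pd i V) x) x := by
      refine (HasPD.of_differentiableAt
        (differentiableAt_of_contDiffOn hD (contDiffOn_pd hD hV i) hx)).congr_fun ?_
      filter_upwards [hD.mem_nhds hx] with q hq using sum_mul_grad hg hq i
    have h3 := h1.2.symm.trans h2.2
    simp only [hg.pd_eq hD hx, add_mul, Finset.sum_add_distrib, Finset.sum_mul] at h3
    have h4 : ∑ k, ∑ l, g x k l * christoffel g l j i x * grad g V k x =
        ∑ l, christoffel g l j i x * pd l V x := by
      rw [Finset.sum_comm]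
      refine Finset.sum_congr rfl fun l _ => ?_
      rw [← sum_mul_grad (V := V) hg hx l, Finset.mul_sum]
      refine Finset.sum_congr rfl fun k _ => ?_
      rw [hg.apply_comm hx k l]
      ring
    have h5 : ∑ k, ∑ l, g x i l * christoffel g l j k x * grad g V k x =
        ∑ k, g x i k * ∑ l, christoffel g k j l x * grad g V l x := by
      rw [Finset.sum_comm]
      simp only [Finset.mul_sum, mul_assoc]
    rw [h4, h5] at h3
    rw [hessian]
    linarith
  rw [← hg.sum_inv_sum_mul hx (fun k => pd j (grad g V k) x) k]
  simp only [hlow, mul_sub, Finset.sum_sub_distrib]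
  rw [hg.sum_inv_sum_mul hx (fun k => ∑ l, christoffel g k j l x * grad g V l x) k]

end Geometry

end

section

/-! ### Warped metrics -/

section Block

variable {n : ℕ} (a : ℝ) (B : Matrix (Fin n) (Fin n) ℝ)

@[simp] theorem blockMatrix_zero_zero : blockMatrix a B 0 0 = a := rfl
@[simp] theorem blockMatrix_zero_succ (j : Fin n) : blockMatrix a B 0 j.succ = 0 := rfl
@[simp] theorem blockMatrix_succ_zero (i : Fin n) : blockMatrix a B i.succ 0 = 0 := rfl
@[simp] theorem blockMatrix_succ_succ (i j : Fin n) : blockMatrix a B i.succ j.succ = B i j := rfl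

theorem smul_blockMatrix (c : ℝ) : c • blockMatrix a B = blockMatrix (c * a) (c • B) := by
  ext i j
  refine Fin.cases ?_ (fun i => ?_) i <;> refine Fin.cases ?_ (fun j => ?_) j <;> simp

variable {a B}

theorem blockMatrix_mul_inv (ha : a ≠ 0) (hB : B.det ≠ 0) :
    blockMatrix a B * blockMatrix a⁻¹ B⁻¹ = 1 := by
  have h := Matrix.mul_nonsing_inv B (isUnit_iff_ne_zero.2 hB)
  ext i j
  refine Fin.cases ?_ (fun i => ?_) i <;> refine Fin.cases ?_ (fun j => ?_) j <;>
    simp [Matrix.mul_apply, Fin.sum_univ_succ, ha, Matrix.one_apply, Fin.succ_ne_zero,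
      (Fin.succ_ne_zero _).symm]
  rw [← Matrix.mul_apply, h, Matrix.one_apply]

theorem blockMatrix_inv (ha : a ≠ 0) (hB : B.det ≠ 0) :
    (blockMatrix a B)⁻¹ = blockMatrix a⁻¹ B⁻¹ :=
  Matrix.inv_eq_right_inv (blockMatrix_mul_inv ha hB)

theorem blockMatrix_det_ne_zero (ha : a ≠ 0) (hB : B.det ≠ 0) : (blockMatrix a B).det ≠ 0 := by
  intro h
  have := congrArg Matrix.det (blockMatrix_mul_inv ha hB)
  simp [h] at this

end Block

theorem smul_inv {n : ℕ} {c : ℝ} (hc : c ≠ 0) {B : Matrix (Fin n) (Fin n) ℝ} (hB : B.det ≠ 0) :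
    (c • B)⁻¹ = c⁻¹ • B⁻¹ := by
  refine Matrix.inv_eq_right_inv ?_
  rw [Matrix.smul_mul, Matrix.mul_smul, smul_smul, mul_inv_cancel₀ hc, one_smul,
    Matrix.mul_nonsing_inv B (isUnit_iff_ne_zero.2 hB)]

theorem exp_two_mul_sub (a b : ℝ) :
    Real.exp (2 * (a - b)) = Real.exp (2 * a) * (Real.exp (2 * b))⁻¹ := by
  rw [mul_sub, Real.exp_sub, div_eq_mul_inv]

/-- The metric `ε e^{2(r(y) + αV)} dy² + e^{2(q(y) - βV)} h_{ij} dx^i dx^j`. -/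
noncomputable def warpMetric {n : ℕ} (ε : ℝ) (r q : ℝ → ℝ) (α β : ℝ) (V : (Fin n → ℝ) → ℝ)
    (h : (Fin n → ℝ) → Matrix (Fin n) (Fin n) ℝ) (P : Fin (n + 1) → ℝ) :
    Matrix (Fin (n + 1)) (Fin (n + 1)) ℝ :=
  blockMatrix (ε * Real.exp (2 * (r (P 0) + α * V (Fin.tail P))))
    (Real.exp (2 * (q (P 0) - β * V (Fin.tail P))) • h (Fin.tail P))

/-- Smoothness assumptions on the data of a warped metric. -/
structure IsWarpData {n : ℕ} (ε : ℝ) (I : Set ℝ) (Ω : Set (Fin n → ℝ)) (r q : ℝ → ℝ)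
    (V : (Fin n → ℝ) → ℝ) (h : (Fin n → ℝ) → Matrix (Fin n) (Fin n) ℝ) : Prop where
  sq_eps : ε * ε = 1
  isOpen_fst : IsOpen I
  isOpen_snd : IsOpen Ω
  smooth_r : ContDiffOn ℝ ∞ r I
  smooth_q : ContDiffOn ℝ ∞ q I
  smooth_V : ContDiffOn ℝ ∞ V Ω
  metric : IsMetricOn Ω h

theorem hasDerivAt_of_contDiffOn {I : Set ℝ} {f : ℝ → ℝ} {y : ℝ} (hI : IsOpen I)
    (hf : ContDiffOn ℝ ∞ f I) (hy : y ∈ I) : HasDerivAt f (deriv f y) y :=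
  (((hf y hy).contDiffAt (hI.mem_nhds hy)).differentiableAt (by simp)).hasDerivAt

theorem hasDerivAt_deriv_of_contDiffOn {I : Set ℝ} {f : ℝ → ℝ} {y : ℝ} (hI : IsOpen I)
    (hf : ContDiffOn ℝ ∞ f I) (hy : y ∈ I) : HasDerivAt (deriv f) (deriv (deriv f) y) y :=
  hasDerivAt_of_contDiffOn hI ((contDiffOn_infty_iff_deriv_of_isOpen hI).1 hf).2 hy

namespace IsWarpData

variable {n : ℕ} {ε α β : ℝ} {I : Set ℝ} {Ω : Set (Fin n → ℝ)} {r q : ℝ → ℝ}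
  {V : (Fin n → ℝ) → ℝ} {h : (Fin n → ℝ) → Matrix (Fin n) (Fin n) ℝ} {P : Fin (n + 1) → ℝ}

theorem eps_ne_zero (w : IsWarpData ε I Ω r q V h) : ε ≠ 0 := by
  rintro rfl
  simpa using w.sq_eps

theorem eps_inv (w : IsWarpData ε I Ω r q V h) : ε⁻¹ = ε :=
  inv_eq_of_mul_eq_one_left w.sq_eps

theorem isMetricOn (w : IsWarpData ε I Ω r q V h) :
    IsMetricOn (cylinder I Ω) (warpMetric ε r q α β V h) where
  smooth i j := by
    have hr := contDiffOn_comp_zero (Ω := Ω) w.smooth_r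
    have hq := contDiffOn_comp_zero (Ω := Ω) w.smooth_q
    have hV := contDiffOn_comp_tail (I := I) w.smooth_V
    refine Fin.cases ?_ (fun i => ?_) i <;> refine Fin.cases ?_ (fun j => ?_) j <;>
      simp only [warpMetric, blockMatrix_zero_zero, blockMatrix_zero_succ, blockMatrix_succ_zero,
        blockMatrix_succ_succ, Matrix.smul_apply, smul_eq_mul]
    · exact contDiffOn_const.mul
        (contDiffOn_const.mul (hr.add (contDiffOn_const.mul hV))).exp
    · exact contDiffOn_const
    · exact contDiffOn_const
    · exact (contDiffOn_const.mul (hq.sub (contDiffOn_const.mul hV))).exp.mul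
        (contDiffOn_comp_tail (w.metric.smooth i j))
  symm P hP := by
    ext i j
    refine Fin.cases ?_ (fun i => ?_) i <;> refine Fin.cases ?_ (fun j => ?_) j <;>
      simp [warpMetric, (w.metric.symm _ hP.2).apply]
  nondegenerate P hP := by
    refine blockMatrix_det_ne_zero (mul_ne_zero w.eps_ne_zero (Real.exp_ne_zero _)) ?_
    rw [Matrix.det_smul]
    exact mul_ne_zero (pow_ne_zero _ (Real.exp_ne_zero _)) (w.metric.nondegenerate _ hP.2)

theorem inv_warpMetric (w : IsWarpData ε I Ω r q V h) (hP : P ∈ cylinder I Ω) :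
    (warpMetric ε r q α β V h P)⁻¹ =
      blockMatrix (ε * Real.exp (-(2 * (r (P 0) + α * V (Fin.tail P)))))
        (Real.exp (-(2 * (q (P 0) - β * V (Fin.tail P)))) • (h (Fin.tail P))⁻¹) := by
  have hd := w.metric.nondegenerate _ hP.2
  rw [warpMetric, blockMatrix_inv (mul_ne_zero w.eps_ne_zero (Real.exp_ne_zero _)),
    smul_inv (Real.exp_ne_zero _) hd, mul_inv, w.eps_inv, Real.exp_neg, Real.exp_neg]
  rw [Matrix.det_smul]
  exact mul_ne_zero (pow_ne_zero _ (Real.exp_ne_zero _)) hd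

section Basic

variable (w : IsWarpData ε I Ω r q V h) (hP : P ∈ cylinder I Ω)
include w hP

theorem hasDerivAt_r : HasDerivAt r (deriv r (P 0)) (P 0) :=
  hasDerivAt_of_contDiffOn w.isOpen_fst w.smooth_r hP.1

theorem hasDerivAt_q : HasDerivAt q (deriv q (P 0)) (P 0) :=
  hasDerivAt_of_contDiffOn w.isOpen_fst w.smooth_q hP.1

theorem hasPD_V (i : Fin n) : HasPD i V (pd i V (Fin.tail P)) (Fin.tail P) :=
  .of_differentiableAt (differentiableAt_of_contDiffOn w.isOpen_snd w.smooth_V hP.2)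

theorem differentiableAt_V : DifferentiableAt ℝ V (Fin.tail P) :=
  differentiableAt_of_contDiffOn w.isOpen_snd w.smooth_V hP.2

theorem differentiableAt_h (i j : Fin n) : DifferentiableAt ℝ (fun x => h x i j) (Fin.tail P) :=
  differentiableAt_of_contDiffOn w.isOpen_snd (w.metric.smooth i j) hP.2

theorem mem_nhds : cylinder I Ω ∈ nhds P :=
  (isOpen_cylinder w.isOpen_fst w.isOpen_snd).mem_nhds hP

theorem pd_metric_zero_zero_zero : pd 0 (fun Q => warpMetric ε r q α β V h Q 0 0) P =
    ε * Real.exp (2 * (r (P 0) + α * V (Fin.tail P))) * (2 * deriv r (P 0)) :=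
  ((((HasPD.zero_zero (w.hasDerivAt_r hP)).add ((HasPD.zero_tail
    (w.differentiableAt_V hP)).const_mul α)).const_mul 2).exp.const_mul ε).2.trans (by ring)

theorem pd_metric_succ_zero_zero (i : Fin n) :
    pd i.succ (fun Q => warpMetric ε r q α β V h Q 0 0) P =
    ε * Real.exp (2 * (r (P 0) + α * V (Fin.tail P))) * (2 * α * pd i V (Fin.tail P)) :=
  ((((HasPD.succ_zero (w.hasDerivAt_r hP) i).add ((HasPD.succ_tail
    (w.hasPD_V hP i)).const_mul α)).const_mul 2).exp.const_mul ε).2.trans (by ring)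

omit w hP in
theorem pd_metric_zero_succ (K : Fin (n + 1)) (i : Fin n) :
    pd K (fun Q => warpMetric ε r q α β V h Q 0 i.succ) P = 0 :=
  (HasPD.const 0).2

omit w hP in
theorem pd_metric_succ_zero (K : Fin (n + 1)) (i : Fin n) :
    pd K (fun Q => warpMetric ε r q α β V h Q i.succ 0) P = 0 :=
  (HasPD.const 0).2

theorem pd_metric_zero_succ_succ (i j : Fin n) :
    pd 0 (fun Q => warpMetric ε r q α β V h Q i.succ j.succ) P =
    Real.exp (2 * (q (P 0) - β * V (Fin.tail P))) * (2 * deriv q (P 0) * h (Fin.tail P) i j) :=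
  ((((HasPD.zero_zero (w.hasDerivAt_q hP)).sub ((HasPD.zero_tail
    (w.differentiableAt_V hP)).const_mul β)).const_mul 2).exp.mul
      (HasPD.zero_tail (w.differentiableAt_h hP i j))).2.trans (by ring)

theorem pd_metric_succ_succ_succ (k i j : Fin n) :
    pd k.succ (fun Q => warpMetric ε r q α β V h Q i.succ j.succ) P =
    Real.exp (2 * (q (P 0) - β * V (Fin.tail P))) * (pd k (fun x => h x i j) (Fin.tail P)
      - 2 * β * pd k V (Fin.tail P) * h (Fin.tail P) i j) :=
  ((((HasPD.succ_zero (w.hasDerivAt_q hP) k).sub ((HasPD.succ_tail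
    (w.hasPD_V hP k)).const_mul β)).const_mul 2).exp.mul
      (HasPD.succ_tail (.of_differentiableAt (w.differentiableAt_h hP i j)))).2.trans (by ring)

/-! #### Christoffel symbols -/

/-- The inverse metric is block diagonal, so only its yy entry contributes, and ε⁻¹ = ε. -/
theorem christoffel_zero (J K : Fin (n + 1)) : christoffel (warpMetric ε r q α β V h) 0 J K P =
    ε * Real.exp (-(2 * (r (P 0) + α * V (Fin.tail P)))) / 2 *
      (pd J (fun Q => warpMetric ε r q α β V h Q 0 K) P +
        pd K (fun Q => warpMetric ε r q α β V h Q 0 J) P -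
        pd 0 (fun Q => warpMetric ε r q α β V h Q J K) P) := by
  rw [christoffel, w.inv_warpMetric hP]
  simp [Fin.sum_univ_succ]
  ring

theorem christoffel_succ (k : Fin n) (J K : Fin (n + 1)) :
    christoffel (warpMetric ε r q α β V h) k.succ J K P =
    Real.exp (-(2 * (q (P 0) - β * V (Fin.tail P)))) / 2 * ∑ l, (h (Fin.tail P))⁻¹ k l *
      (pd J (fun Q => warpMetric ε r q α β V h Q l.succ K) P +
        pd K (fun Q => warpMetric ε r q α β V h Q l.succ J) P -
        pd l.succ (fun Q => warpMetric ε r q α β V h Q J K) P) := by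
  rw [christoffel, w.inv_warpMetric hP]
  simp only [Fin.sum_univ_succ, blockMatrix_succ_zero, blockMatrix_succ_succ, Matrix.smul_apply,
    smul_eq_mul, zero_mul, zero_add, mul_assoc, ← Finset.mul_sum]
  ring

theorem christoffel_zero_zero_zero :
    christoffel (warpMetric ε r q α β V h) 0 0 0 P = deriv r (P 0) := by
  rw [w.christoffel_zero hP, w.pd_metric_zero_zero_zero hP, Real.exp_neg]
  have := Real.exp_ne_zero (2 * (r (P 0) + α * V (Fin.tail P)))
  -- From here the exponential enters only as E and E⁻¹, so the identity is algebraic and needs only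
  -- ε² = 1.
  generalize Real.exp (2 * (r (P 0) + α * V (Fin.tail P))) = E at *
  field_simp
  linear_combination (deriv r (P 0)) * w.sq_eps

theorem christoffel_zero_zero_succ (i : Fin n) :
    christoffel (warpMetric ε r q α β V h) 0 0 i.succ P = α * pd i V (Fin.tail P) := by
  rw [w.christoffel_zero hP, w.pd_metric_succ_zero_zero hP, pd_metric_zero_succ, Real.exp_neg]
  have := Real.exp_ne_zero (2 * (r (P 0) + α * V (Fin.tail P)))
  generalize Real.exp (2 * (r (P 0) + α * V (Fin.tail P))) = E at *
  linear_combination (α * pd i V (Fin.tail P)) * w.sq_eps +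
    ε * ε * α * pd i V (Fin.tail P) * mul_inv_cancel₀ this

theorem christoffel_zero_succ_zero (i : Fin n) :
    christoffel (warpMetric ε r q α β V h) 0 i.succ 0 P = α * pd i V (Fin.tail P) := by
  rw [w.isMetricOn.christoffel_comm (isOpen_cylinder w.isOpen_fst w.isOpen_snd) hP,
    w.christoffel_zero_zero_succ hP]

theorem christoffel_zero_succ_succ (i j : Fin n) :
    christoffel (warpMetric ε r q α β V h) 0 i.succ j.succ P =
      -(ε * (Real.exp (2 * ((q (P 0) - β * V (Fin.tail P)) - (r (P 0) + α * V (Fin.tail P))))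
        * (deriv q (P 0) * h (Fin.tail P) i j))) := by
  rw [w.christoffel_zero hP, w.pd_metric_zero_succ_succ hP, pd_metric_zero_succ,
    pd_metric_zero_succ, exp_two_mul_sub (q (P 0) - β * V (Fin.tail P)), Real.exp_neg]
  have := Real.exp_ne_zero (2 * (r (P 0) + α * V (Fin.tail P)))
  generalize Real.exp (2 * (r (P 0) + α * V (Fin.tail P))) = E at *
  field_simp
  ring

theorem christoffel_succ_zero_zero (k : Fin n) :
    christoffel (warpMetric ε r q α β V h) k.succ 0 0 P =
      -(ε * (Real.exp (2 * ((r (P 0) + α * V (Fin.tail P)) - (q (P 0) - β * V (Fin.tail P))))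
        * (α * grad h V k (Fin.tail P)))) := by
  rw [w.christoffel_succ hP, exp_two_mul_sub (r (P 0) + α * V (Fin.tail P)), Real.exp_neg, grad]
  simp only [pd_metric_succ_zero, w.pd_metric_succ_zero_zero hP, Finset.mul_sum,
    ← Finset.sum_neg_distrib]
  refine Finset.sum_congr rfl fun l _ => ?_
  have := Real.exp_ne_zero (2 * (q (P 0) - β * V (Fin.tail P)))
  generalize Real.exp (2 * (q (P 0) - β * V (Fin.tail P))) = F at *
  field_simp
  ring

theorem christoffel_succ_zero_succ (k j : Fin n) :
    christoffel (warpMetric ε r q α β V h) k.succ 0 j.succ P =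
      if k = j then deriv q (P 0) else 0 := by
  have h1 : ∑ l, (h (Fin.tail P))⁻¹ k l * h (Fin.tail P) l j = _ :=
    w.metric.sum_inv_mul hP.2 k j
  -- Writing the Kronecker delta as the contraction h⁻¹h makes both sides sums over the same index,
  -- to be compared term by term.
  have h2 : (if k = j then deriv q (P 0) else 0) =
      deriv q (P 0) * ∑ l, (h (Fin.tail P))⁻¹ k l * h (Fin.tail P) l j := by
    rw [h1]; split_ifs <;> simp
  rw [w.christoffel_succ hP, h2, Real.exp_neg]
  simp only [pd_metric_succ_zero, pd_metric_zero_succ, w.pd_metric_zero_succ_succ hP,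
    Finset.mul_sum]
  refine Finset.sum_congr rfl fun l _ => ?_
  have := Real.exp_ne_zero (2 * (q (P 0) - β * V (Fin.tail P)))
  generalize Real.exp (2 * (q (P 0) - β * V (Fin.tail P))) = F at *
  field_simp
  ring

theorem christoffel_succ_succ_zero (k j : Fin n) :
    christoffel (warpMetric ε r q α β V h) k.succ j.succ 0 P =
      if k = j then deriv q (P 0) else 0 := by
  rw [w.isMetricOn.christoffel_comm (isOpen_cylinder w.isOpen_fst w.isOpen_snd) hP,
    w.christoffel_succ_zero_succ hP]

/-- This is the conformal change formula for the factor e^{-2βV}; the factor e^{2q(y)} is constant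
in x and drops out. -/
theorem christoffel_succ_succ_succ (k i j : Fin n) :
    christoffel (warpMetric ε r q α β V h) k.succ i.succ j.succ P =
      christoffel h k i j (Fin.tail P) - β * ((if k = i then 1 else 0) * pd j V (Fin.tail P)
        + (if k = j then 1 else 0) * pd i V (Fin.tail P)
        - h (Fin.tail P) i j * grad h V k (Fin.tail P)) := by
  rw [w.christoffel_succ hP, ← w.metric.sum_inv_mul hP.2 k i, ← w.metric.sum_inv_mul hP.2 k j,
    Real.exp_neg, christoffel, grad]
  simp only [w.pd_metric_succ_succ_succ hP, Finset.mul_sum, Finset.sum_mul,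
    ← Finset.sum_add_distrib, ← Finset.sum_sub_distrib]
  refine Finset.sum_congr rfl fun l _ => ?_
  have := Real.exp_ne_zero (2 * (q (P 0) - β * V (Fin.tail P)))
  generalize Real.exp (2 * (q (P 0) - β * V (Fin.tail P))) = F at *
  field_simp
  ring

/-! #### Derivatives of the Christoffel symbols -/

theorem pd_zero_christoffel_zero_zero_zero :
    pd 0 (christoffel (warpMetric ε r q α β V h) 0 0 0) P = deriv (deriv r) (P 0) :=
  ((HasPD.zero_zero (hasDerivAt_deriv_of_contDiffOn w.isOpen_fst w.smooth_r hP.1)).congr_fun <| by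
    filter_upwards [w.mem_nhds hP] with Q hQ using w.christoffel_zero_zero_zero hQ).2

theorem pd_succ_christoffel_zero_zero_zero (i : Fin n) :
    pd i.succ (christoffel (warpMetric ε r q α β V h) 0 0 0) P = 0 :=
  ((HasPD.succ_zero
      (hasDerivAt_deriv_of_contDiffOn w.isOpen_fst w.smooth_r hP.1) i).congr_fun <| by
    filter_upwards [w.mem_nhds hP] with Q hQ using w.christoffel_zero_zero_zero hQ).2

theorem hasPD_pd_V (i j : Fin n) :
    HasPD i (pd j V) (pd i (pd j V) (Fin.tail P)) (Fin.tail P) :=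
  .of_differentiableAt (differentiableAt_of_contDiffOn w.isOpen_snd
    (contDiffOn_pd w.isOpen_snd w.smooth_V j) hP.2)

theorem hasPD_grad (i j : Fin n) :
    HasPD i (grad h V j) (pd i (grad h V j) (Fin.tail P)) (Fin.tail P) :=
  .of_differentiableAt (differentiableAt_of_contDiffOn w.isOpen_snd
    (contDiffOn_grad w.isOpen_snd w.metric w.smooth_V j) hP.2)

theorem hasPD_christoffel (l k i j : Fin n) : HasPD l (christoffel h k i j)
    (pd l (christoffel h k i j) (Fin.tail P)) (Fin.tail P) :=
  .of_differentiableAt (differentiableAt_of_contDiffOn w.isOpen_snd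
    (w.metric.contDiffOn_christoffel w.isOpen_snd k i j) hP.2)

theorem pd_zero_christoffel_zero_zero_succ (i : Fin n) :
    pd 0 (christoffel (warpMetric ε r q α β V h) 0 0 i.succ) P = 0 :=
  -- Only the differentiability of ∂_i V is used here, so the direction of its derivative is a
  -- dummy.
  (((HasPD.zero_tail (w.hasPD_pd_V hP i i).1).const_mul α).congr_fun <| by
    filter_upwards [w.mem_nhds hP] with Q hQ using w.christoffel_zero_zero_succ hQ i).2.trans
      (mul_zero α)

theorem pd_zero_christoffel_zero_succ_zero (i : Fin n) :
    pd 0 (christoffel (warpMetric ε r q α β V h) 0 i.succ 0) P = 0 :=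
  (((HasPD.zero_tail (w.hasPD_pd_V hP i i).1).const_mul α).congr_fun <| by
    filter_upwards [w.mem_nhds hP] with Q hQ using w.christoffel_zero_succ_zero hQ i).2.trans
      (mul_zero α)

theorem pd_succ_christoffel_zero_succ_zero (j i : Fin n) :
    pd j.succ (christoffel (warpMetric ε r q α β V h) 0 i.succ 0) P =
      α * pd j (pd i V) (Fin.tail P) :=
  (((HasPD.succ_tail (w.hasPD_pd_V hP j i)).const_mul α).congr_fun <| by
    filter_upwards [w.mem_nhds hP] with Q hQ using w.christoffel_zero_succ_zero hQ i).2

theorem pd_zero_christoffel_zero_succ_succ (i j : Fin n) :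
    pd 0 (christoffel (warpMetric ε r q α β V h) 0 i.succ j.succ) P =
      -(ε * (Real.exp (2 * ((q (P 0) - β * V (Fin.tail P)) - (r (P 0) + α * V (Fin.tail P))))
        * ((deriv (deriv q) (P 0) + 2 * (deriv q (P 0) - deriv r (P 0)) * deriv q (P 0))
          * h (Fin.tail P) i j))) := by
  have hV := HasPD.zero_tail (w.differentiableAt_V hP)
  have h1 := ((HasPD.zero_zero (w.hasDerivAt_q hP)).sub (hV.const_mul β)).sub
    ((HasPD.zero_zero (w.hasDerivAt_r hP)).add (hV.const_mul α))
  have h2 := (HasPD.zero_zero (hasDerivAt_deriv_of_contDiffOn w.isOpen_fst w.smooth_q hP.1)).mul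
    (HasPD.zero_tail (w.differentiableAt_h hP i j))
  refine ((((h1.const_mul 2).exp.mul h2).const_mul ε).neg.congr_fun ?_).2.trans ?_
  · filter_upwards [w.mem_nhds hP] with Q hQ using w.christoffel_zero_succ_succ hQ i j
  · ring

theorem pd_succ_christoffel_succ_zero_zero (l k : Fin n) :
    pd l.succ (christoffel (warpMetric ε r q α β V h) k.succ 0 0) P =
      -(ε * (Real.exp (2 * ((r (P 0) + α * V (Fin.tail P)) - (q (P 0) - β * V (Fin.tail P))))
        * (α * (2 * (α + β) * pd l V (Fin.tail P) * grad h V k (Fin.tail P)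
          + pd l (grad h V k) (Fin.tail P))))) := by
  have hV := HasPD.succ_tail (w.hasPD_V hP l)
  have h1 := ((HasPD.succ_zero (w.hasDerivAt_r hP) l).add (hV.const_mul α)).sub
    ((HasPD.succ_zero (w.hasDerivAt_q hP) l).sub (hV.const_mul β))
  have h2 := (HasPD.succ_tail (w.hasPD_grad hP l k)).const_mul α
  refine ((((h1.const_mul 2).exp.mul h2).const_mul ε).neg.congr_fun ?_).2.trans ?_
  · filter_upwards [w.mem_nhds hP] with Q hQ using w.christoffel_succ_zero_zero hQ k
  · ring

theorem hasDerivAt_ite (c : Prop) [Decidable c] :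
    HasDerivAt (fun y => if c then deriv q y else 0)
      (if c then deriv (deriv q) (P 0) else 0) (P 0) := by
  split_ifs
  · exact hasDerivAt_deriv_of_contDiffOn w.isOpen_fst w.smooth_q hP.1
  · exact hasDerivAt_const _ _

theorem pd_zero_christoffel_succ_zero_succ (k j : Fin n) :
    pd 0 (christoffel (warpMetric ε r q α β V h) k.succ 0 j.succ) P =
      if k = j then deriv (deriv q) (P 0) else 0 :=
  ((HasPD.zero_zero (w.hasDerivAt_ite hP (k = j))).congr_fun <| by
    filter_upwards [w.mem_nhds hP] with Q hQ using w.christoffel_succ_zero_succ hQ k j).2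

theorem pd_succ_christoffel_succ_zero_succ (l k j : Fin n) :
    pd l.succ (christoffel (warpMetric ε r q α β V h) k.succ 0 j.succ) P = 0 :=
  ((HasPD.succ_zero (w.hasDerivAt_ite hP (k = j)) l).congr_fun <| by
    filter_upwards [w.mem_nhds hP] with Q hQ using w.christoffel_succ_zero_succ hQ k j).2

theorem pd_zero_christoffel_succ_succ_succ (k i j : Fin n) :
    pd 0 (christoffel (warpMetric ε r q α β V h) k.succ i.succ j.succ) P = 0 := by
  have h1 := (HasPD.zero_tail (w.hasPD_pd_V hP i j).1).const_mul (if k = i then 1 else 0)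
  have h2 := (HasPD.zero_tail (w.hasPD_pd_V hP i i).1).const_mul (if k = j then 1 else 0)
  have h3 := (HasPD.zero_tail (w.differentiableAt_h hP i j)).mul
    (HasPD.zero_tail (w.hasPD_grad hP i k).1)
  refine (((HasPD.zero_tail (w.hasPD_christoffel hP i k i j).1).sub
    (((h1.add h2).sub h3).const_mul β)).congr_fun ?_).2.trans ?_
  · filter_upwards [w.mem_nhds hP] with Q hQ using w.christoffel_succ_succ_succ hQ k i j
  · ring

theorem pd_succ_christoffel_succ_succ_succ (l k i j : Fin n) :
    pd l.succ (christoffel (warpMetric ε r q α β V h) k.succ i.succ j.succ) P =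
      pd l (christoffel h k i j) (Fin.tail P)
        - β * ((if k = i then 1 else 0) * pd l (pd j V) (Fin.tail P)
        + (if k = j then 1 else 0) * pd l (pd i V) (Fin.tail P)
        - (pd l (fun x => h x i j) (Fin.tail P) * grad h V k (Fin.tail P)
          + h (Fin.tail P) i j * pd l (grad h V k) (Fin.tail P))) := by
  have h1 := (HasPD.succ_tail (w.hasPD_pd_V hP l j)).const_mul (if k = i then 1 else 0)
  have h2 := (HasPD.succ_tail (w.hasPD_pd_V hP l i)).const_mul (if k = j then 1 else 0)
  have h3 := (HasPD.succ_tail (i := l) (.of_differentiableAt (w.differentiableAt_h hP i j))).mul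
    (HasPD.succ_tail (w.hasPD_grad hP l k))
  refine (((HasPD.succ_tail (w.hasPD_christoffel hP l k i j)).sub
    (((h1.add h2).sub h3).const_mul β)).congr_fun ?_).2
  filter_upwards [w.mem_nhds hP] with Q hQ using w.christoffel_succ_succ_succ hQ k i j

end Basic

end IsWarpData

end

/-! ### The Ricci tensor of a warped metric -/

section

/-- The grouping isolates the traces Γ^k_{kl}, which are simple for a warped metric. -/
theorem ricci_eq {m : ℕ} (g : (Fin m → ℝ) → Matrix (Fin m) (Fin m) ℝ) (i j : Fin m)
    (p : Fin m → ℝ) : ricci g i j p =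
      ∑ k, pd k (christoffel g k i j) p - ∑ k, pd j (christoffel g k i k) p
      + ∑ l, (∑ k, christoffel g k k l p) * christoffel g l i j p
      - ∑ k, ∑ l, christoffel g k j l p * christoffel g l i k p := by
  simp only [ricci, Finset.sum_add_distrib, Finset.sum_sub_distrib, Finset.sum_mul]
  rw [Finset.sum_comm (f := fun k l => christoffel g k k l p * christoffel g l i j p)]
  ring

/-- `ricci_eq` with the contracted Christoffel symbols given by `t`. -/
theorem ricci_eq_of_trace {m : ℕ} {g : (Fin m → ℝ) → Matrix (Fin m) (Fin m) ℝ} {p : Fin m → ℝ}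
    {t : Fin m → ℝ} (ht : ∀ l, ∑ k, christoffel g k k l p = t l) (i j : Fin m) :
    ricci g i j p =
      ∑ k, pd k (christoffel g k i j) p - ∑ k, pd j (christoffel g k i k) p
      + ∑ l, t l * christoffel g l i j p
      - ∑ k, ∑ l, christoffel g k j l p * christoffel g l i k p := by
  simp only [ricci_eq, ht]

/-- The squared norm `g^{kl} ∂_k V ∂_l V` of the gradient. -/
noncomputable def gradSq {m : ℕ} (g : (Fin m → ℝ) → Matrix (Fin m) (Fin m) ℝ)
    (V : (Fin m → ℝ) → ℝ) (x : Fin m → ℝ) : ℝ := ∑ k, pd k V x * grad g V k x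

/-- Trace of `pd_grad`. The trace of Γ that it produces cancels against the one in the Ricci tensor,
leaving the invariant □. -/
theorem sum_pd_grad {m : ℕ} {D : Set (Fin m → ℝ)} {g : (Fin m → ℝ) → Matrix (Fin m) (Fin m) ℝ}
    {V : (Fin m → ℝ) → ℝ} {x : Fin m → ℝ} (hD : IsOpen D) (hg : IsMetricOn D g)
    (hV : ContDiffOn ℝ ∞ V D) (hx : x ∈ D) :
    ∑ k, pd k (grad g V k) x =
      box g V x - ∑ l, (∑ k, christoffel g k k l x) * grad g V l x := by
  simp only [pd_grad hD hg hV hx, Finset.sum_sub_distrib, Finset.sum_mul, box]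
  rw [Finset.sum_comm (f := fun k l => christoffel g k k l x * grad g V l x)]

theorem sum_delta_mul {n : ℕ} (i : Fin n) (f : Fin n → ℝ) :
    ∑ k, (if k = i then (1 : ℝ) else 0) * f k = f i := by simp

theorem sum_delta_mul' {n : ℕ} (i : Fin n) (f : Fin n → ℝ) :
    ∑ k, (if i = k then (1 : ℝ) else 0) * f k = f i := by simp

/-- Change of the quadratic term of the Ricci tensor when a connection `Γ` is modified by a
conformal difference tensor. -/
theorem sum_sum_conformal_mul {n : ℕ} (Γ : Fin n → Fin n → Fin n → ℝ)
    (V u : Fin n → ℝ) (h : Fin n → Fin n → ℝ) (hs : ∀ i j, h i j = h j i)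
    (hu : ∀ i, ∑ k, h i k * u k = V i) (β : ℝ) (i j : Fin n) :
    ∑ k, ∑ l, (Γ k j l - β * ((if k = j then 1 else 0) * V l + (if k = l then 1 else 0) * V j
        - h j l * u k)) * (Γ l i k - β * ((if l = i then 1 else 0) * V k
        + (if l = k then 1 else 0) * V i - h i k * u l)) =
      ∑ k, ∑ l, Γ k j l * Γ l i k
      - β * (∑ k, Γ k j i * V k + V i * ∑ k, Γ k j k - ∑ k, ∑ l, h i k * (Γ k j l * u l))
      - β * (∑ k, Γ k i j * V k + V j * ∑ k, Γ k i k - ∑ k, ∑ l, h j k * (Γ k i l * u l))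
      + β ^ 2 * ((n + 2) * V i * V j - 2 * h i j * ∑ k, V k * u k) := by
  -- The terms linear in the difference tensor. The other mixed product is this one with i and j
  -- exchanged and the sums swapped.
  have cross : ∀ i j, ∑ k, ∑ l, Γ k j l * ((if l = i then 1 else 0) * V k
      + (if l = k then 1 else 0) * V i - h i k * u l) =
      ∑ k, Γ k j i * V k + V i * ∑ k, Γ k j k - ∑ k, ∑ l, h i k * (Γ k j l * u l) := by
    intro i j
    rw [Finset.mul_sum, ← Finset.sum_add_distrib, ← Finset.sum_sub_distrib]
    refine Finset.sum_congr rfl fun k _ => ?_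
    calc _ = ∑ l, ((if l = i then (1 : ℝ) else 0) * (Γ k j l * V k)
            + (if l = k then (1 : ℝ) else 0) * (Γ k j l * V i) - h i k * (Γ k j l * u l)) :=
          Finset.sum_congr rfl fun l _ => by ring
      _ = _ := by
          rw [Finset.sum_sub_distrib, Finset.sum_add_distrib, sum_delta_mul, sum_delta_mul]
          ring
  -- The terms quadratic in the difference tensor: every sum collapses by a Kronecker delta, by
  -- lowering u to V, or to the norm of V.
  have quad : ∑ k, ∑ l, ((if k = j then 1 else 0) * V l + (if k = l then 1 else 0) * V j
        - h j l * u k) * ((if l = i then 1 else 0) * V k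
        + (if l = k then 1 else 0) * V i - h i k * u l) =
      (n + 2) * V i * V j - 2 * h i j * ∑ k, V k * u k := by
    have inner : ∀ k, ∑ l, ((if k = j then 1 else 0) * V l + (if k = l then 1 else 0) * V j
        - h j l * u k) * ((if l = i then 1 else 0) * V k
        + (if l = k then 1 else 0) * V i - h i k * u l) =
        (if k = j then 1 else 0) * (V k * V i + V i * V k - h i k * ∑ l, V l * u l)
        + (if k = i then 1 else 0) * (V j * V k) + V i * V j - V j * (h i k * u k)
        - h j i * (V k * u k) - V i * (h j k * u k) + V j * (h i k * u k) := by
      intro k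
      calc _ = ∑ l, ((if l = i then 1 else 0) * ((if k = j then 1 else 0) * V l * V k
              + (if k = l then 1 else 0) * (V j * V k) - h j l * u k * V k)
            + (if l = k then 1 else 0) * (((if k = j then 1 else 0) * V l
              + (if k = l then 1 else 0) * V j - h j l * u k) * V i)
            - (if k = j then 1 else 0) * h i k * (V l * u l)
            - (if k = l then 1 else 0) * (V j * (h i k * u l))
            + h i k * u k * (h j l * u l)) := Finset.sum_congr rfl fun l _ => by ring
        _ = _ := by
            rw [Finset.sum_add_distrib, Finset.sum_sub_distrib, Finset.sum_sub_distrib,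
              Finset.sum_add_distrib, sum_delta_mul, sum_delta_mul, sum_delta_mul',
              ← Finset.mul_sum, ← Finset.mul_sum, hu]
            simp only [if_true]
            ring
    simp only [inner]
    rw [Finset.sum_add_distrib, Finset.sum_sub_distrib, Finset.sum_sub_distrib,
      Finset.sum_sub_distrib, Finset.sum_add_distrib, Finset.sum_add_distrib, sum_delta_mul,
      sum_delta_mul, ← Finset.mul_sum, ← Finset.mul_sum, ← Finset.mul_sum, ← Finset.mul_sum,
      hu, hu, hs j i]
    simp
    ring
  have cross' : ∑ k, ∑ l, Γ l i k * ((if k = j then 1 else 0) * V l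
      + (if k = l then 1 else 0) * V j - h j l * u k) = _ :=
    Finset.sum_comm.trans (cross j i)
  rw [← cross i j, ← cross', ← quad]
  simp only [Finset.mul_sum, ← Finset.sum_add_distrib, ← Finset.sum_sub_distrib]
  exact Finset.sum_congr rfl fun k _ => Finset.sum_congr rfl fun l _ => by ring

namespace IsWarpData

variable {n : ℕ} {ε α β : ℝ} {I : Set ℝ} {Ω : Set (Fin n → ℝ)} {r q : ℝ → ℝ}
  {V : (Fin n → ℝ) → ℝ} {h : (Fin n → ℝ) → Matrix (Fin n) (Fin n) ℝ} {P : Fin (n + 1) → ℝ}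

variable (w : IsWarpData ε I Ω r q V h) (hP : P ∈ cylinder I Ω)
include w hP

theorem trace_christoffel_zero : ∑ K, christoffel (warpMetric ε r q α β V h) K K 0 P =
    deriv r (P 0) + n * deriv q (P 0) := by
  simp [Fin.sum_univ_succ, w.christoffel_zero_zero_zero hP, w.christoffel_succ_succ_zero hP]

theorem trace_christoffel_succ (i : Fin n) :
    ∑ K, christoffel (warpMetric ε r q α β V h) K K i.succ P =
    ∑ k, christoffel h k k i (Fin.tail P) + (α - n * β) * pd i V (Fin.tail P) := by
  have h1 : ∑ k, h (Fin.tail P) k i * grad h V k (Fin.tail P) = pd i V (Fin.tail P) := by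
    rw [← sum_mul_grad w.metric hP.2 i]
    exact Finset.sum_congr rfl fun k _ => by rw [w.metric.apply_comm hP.2 k i]
  rw [Fin.sum_univ_succ, w.christoffel_zero_zero_succ hP]
  simp only [w.christoffel_succ_succ_succ hP, Finset.sum_sub_distrib, ← Finset.mul_sum,
    Finset.sum_add_distrib, sum_delta_mul, h1]
  simp
  ring

theorem trace_christoffel (L : Fin (n + 1)) :
    ∑ K, christoffel (warpMetric ε r q α β V h) K K L P =
    (Fin.cons (deriv r (P 0) + n * deriv q (P 0)) fun i =>
      ∑ k, christoffel h k k i (Fin.tail P) + (α - n * β) * pd i V (Fin.tail P) :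
        Fin (n + 1) → ℝ) L := by
  refine Fin.cases ?_ (fun i => ?_) L
  · rw [w.trace_christoffel_zero hP, Fin.cons_zero]
  · rw [w.trace_christoffel_succ hP, Fin.cons_succ]

theorem ricci_zero_zero : ricci (warpMetric ε r q α β V h) 0 0 P =
    -(ε * (Real.exp (2 * ((r (P 0) + α * V (Fin.tail P)) - (q (P 0) - β * V (Fin.tail P))))
      * (α * (box h V (Fin.tail P) + (α - (n - 2) * β) * gradSq h V (Fin.tail P)))))
    - n * (deriv (deriv q) (P 0) + deriv q (P 0) ^ 2 - deriv r (P 0) * deriv q (P 0)) := by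
  have hd := sum_pd_grad w.isOpen_snd w.metric w.smooth_V hP.2
  rw [ricci_eq_of_trace (w.trace_christoffel hP)]
  simp only [Fin.sum_univ_succ (n := n), Fin.cons_zero, Fin.cons_succ,
    w.pd_zero_christoffel_zero_zero_zero hP,
    w.pd_succ_christoffel_succ_zero_zero hP, w.pd_zero_christoffel_succ_zero_succ hP,
    w.christoffel_zero_zero_zero hP, w.christoffel_zero_zero_succ hP,
    w.christoffel_succ_zero_zero hP, w.christoffel_succ_zero_succ hP]
  generalize Real.exp (2 * (r (P 0) + α * V (Fin.tail P) - (q (P 0) - β * V (Fin.tail P)))) = E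
  have e1 : ∑ k, -(ε * (E * (α * (2 * (α + β) * pd k V (Fin.tail P) * grad h V k (Fin.tail P)
      + pd k (grad h V k) (Fin.tail P))))) = -(ε * E * α) * (2 * (α + β) * gradSq h V (Fin.tail P)
      + ∑ k, pd k (grad h V k) (Fin.tail P)) := by
    simp only [gradSq, Finset.mul_sum, ← Finset.sum_add_distrib]
    exact Finset.sum_congr rfl fun k _ => by ring
  have e2 : ∑ x, (∑ k, christoffel h k k x (Fin.tail P) + (α - n * β) * pd x V (Fin.tail P)) *
      -(ε * (E * (α * grad h V x (Fin.tail P)))) = -(ε * E * α) *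
        (∑ x, (∑ k, christoffel h k k x (Fin.tail P)) * grad h V x (Fin.tail P)
        + (α - n * β) * gradSq h V (Fin.tail P)) := by
    simp only [gradSq, Finset.mul_sum, ← Finset.sum_add_distrib]
    exact Finset.sum_congr rfl fun k _ => by ring
  have e3 : ∑ x, α * pd x V (Fin.tail P) * -(ε * (E * (α * grad h V x (Fin.tail P)))) =
      -(ε * E * α) * (α * gradSq h V (Fin.tail P)) := by
    simp only [gradSq, Finset.mul_sum]
    exact Finset.sum_congr rfl fun k _ => by ring
  have e4 : ∑ x, -(ε * (E * (α * grad h V x (Fin.tail P)))) * (α * pd x V (Fin.tail P)) =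
      -(ε * E * α) * (α * gradSq h V (Fin.tail P)) := by
    simp only [gradSq, Finset.mul_sum]
    exact Finset.sum_congr rfl fun k _ => by ring
  simp only [Finset.sum_add_distrib (f := fun x => -(ε * (E * (α * grad h V x (Fin.tail P)))) *
    (α * pd x V (Fin.tail P)))]
  -- Every sum is now a multiple of -εEα. Inserting the divergence formula cancels the traces of Γ
  -- between `e1` and `e2`.
  rw [e1, e2, e3, e4, hd]
  simp
  ring

theorem ricci_zero_succ (i : Fin n) : ricci (warpMetric ε r q α β V h) 0 i.succ P =
    (n - 1) * α * deriv q (P 0) * pd i V (Fin.tail P) := by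
  have ti := w.trace_christoffel_succ (α := α) (β := β) hP i
  have e := sum_mul_grad w.metric hP.2 (V := V) i
  rw [ricci_eq_of_trace (w.trace_christoffel hP)]
  rw [Fin.sum_univ_succ, w.christoffel_zero_zero_succ hP] at ti
  simp only [Fin.sum_univ_succ (n := n), Fin.cons_zero, Fin.cons_succ,
    w.pd_zero_christoffel_zero_zero_succ hP,
    w.pd_succ_christoffel_succ_zero_succ hP, w.pd_succ_christoffel_zero_zero_zero hP,
    w.christoffel_zero_zero_zero hP, w.christoffel_zero_zero_succ hP,
    w.christoffel_zero_succ_zero hP, w.christoffel_zero_succ_succ hP,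
    w.christoffel_succ_zero_zero hP, w.christoffel_succ_zero_succ hP,
    w.christoffel_succ_succ_zero hP]
  -- The exponentials in Γ^0_{il} and Γ^l_{00} are reciprocal, so their product leaves no
  -- exponential in the mixed component.
  have hE : Real.exp (2 * ((q (P 0) - β * V (Fin.tail P)) - (r (P 0) + α * V (Fin.tail P)))) *
      Real.exp (2 * ((r (P 0) + α * V (Fin.tail P)) - (q (P 0) - β * V (Fin.tail P)))) = 1 := by
    rw [← Real.exp_add]; simp only [Real.exp_eq_one_iff]; ring
  generalize Real.exp (2 * (r (P 0) + α * V (Fin.tail P) - (q (P 0) - β * V (Fin.tail P)))) = E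
    at *
  generalize Real.exp (2 * (q (P 0) - β * V (Fin.tail P) - (r (P 0) + α * V (Fin.tail P)))) = F
    at *
  have e1 : ∑ l, -(ε * (F * (deriv q (P 0) * h (Fin.tail P) i l))) *
      -(ε * (E * (α * grad h V l (Fin.tail P)))) = α * deriv q (P 0) * pd i V (Fin.tail P) := by
    rw [← e, Finset.mul_sum]
    refine Finset.sum_congr rfl fun l _ => ?_
    linear_combination (α * deriv q (P 0) * h (Fin.tail P) i l * grad h V l (Fin.tail P)) *
      (F * E * w.sq_eps + hE)
  -- The spatial trace is the full trace minus its yy part.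
  have e2 : ∑ k : Fin n, christoffel (warpMetric ε r q α β V h) k.succ i.succ k.succ P =
      ∑ k, christoffel h k k i (Fin.tail P) + (α - n * β) * pd i V (Fin.tail P)
        - α * pd i V (Fin.tail P) := by
    rw [← ti, add_sub_cancel_left]
    exact Finset.sum_congr rfl fun k _ => w.isMetricOn.christoffel_comm
      (isOpen_cylinder w.isOpen_fst w.isOpen_snd) hP _ _ _
  have e3 : ∑ k : Fin n, ∑ l : Fin n, christoffel (warpMetric ε r q α β V h) k.succ i.succ l.succ P *
      (if l = k then deriv q (P 0) else 0) = deriv q (P 0) *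
      ∑ k : Fin n, christoffel (warpMetric ε r q α β V h) k.succ i.succ k.succ P := by
    rw [Finset.mul_sum]
    refine Finset.sum_congr rfl fun k _ => ?_
    simp [mul_comm]
  simp only [Finset.sum_add_distrib 
      (f := fun k : Fin n => (if k = i then deriv q (P 0) else 0) * _), e1,
    e3, e2]
  simp
  ring

/-- The only part of the Ricci tensor not visibly symmetric is the derivative of the trace of Γ, and
for this pair of indices it vanishes in both orders. -/
theorem ricci_succ_zero (i : Fin n) : ricci (warpMetric ε r q α β V h) i.succ 0 P =
    (n - 1) * α * deriv q (P 0) * pd i V (Fin.tail P) := by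
  have hc : ∀ K J L, christoffel (warpMetric ε r q α β V h) K J L P =
      christoffel (warpMetric ε r q α β V h) K L J P := fun K J L =>
    w.isMetricOn.christoffel_comm (isOpen_cylinder w.isOpen_fst w.isOpen_snd) hP _ _ _
  rw [← w.ricci_zero_succ hP, ricci_eq, ricci_eq]
  have d1 : ∀ K, pd K (christoffel (warpMetric ε r q α β V h) K i.succ 0) P =
      pd K (christoffel (warpMetric ε r q α β V h) K 0 i.succ) P := fun K => by
    have : christoffel (warpMetric ε r q α β V h) K i.succ 0 =ᶠ[nhds P]
        christoffel (warpMetric ε r q α β V h) K 0 i.succ := by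
      filter_upwards [w.mem_nhds hP] with Q hQ using w.isMetricOn.christoffel_comm
        (isOpen_cylinder w.isOpen_fst w.isOpen_snd) hQ _ _ _
    rw [pd, pd, this.fderiv_eq]
  have d2 : ∑ K, pd 0 (christoffel (warpMetric ε r q α β V h) K i.succ K) P = 0 := by
    simp [Fin.sum_univ_succ (n := n), w.pd_zero_christoffel_zero_succ_zero hP,
      w.pd_zero_christoffel_succ_succ_succ hP]
  have d3 : ∑ K, pd i.succ (christoffel (warpMetric ε r q α β V h) K 0 K) P = 0 := by
    simp [Fin.sum_univ_succ (n := n), w.pd_succ_christoffel_zero_zero_zero hP,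
      w.pd_succ_christoffel_succ_zero_succ hP]
  rw [d2, d3, Finset.sum_congr rfl fun K _ => d1 K]
  simp only [hc _ i.succ 0]
  congr 1
  rw [Finset.sum_comm]
  exact Finset.sum_congr rfl fun K _ => Finset.sum_congr rfl fun L _ => mul_comm _ _

/-- The spatial Christoffel symbols are those of `h` modified by a conformal difference tensor, so
this is the conformal change of Ric(h) plus the terms with an index 0. -/
theorem ricci_succ_succ (i j : Fin n) : ricci (warpMetric ε r q α β V h) i.succ j.succ P =
    ricci h i j (Fin.tail P) + ((n - 2) * β - α) * hessian h V i j (Fin.tail P)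
    + ((n - 2) * β ^ 2 - α ^ 2 - 2 * α * β) * (pd i V (Fin.tail P) * pd j V (Fin.tail P))
    + h (Fin.tail P) i j * (β * box h V (Fin.tail P)
      + (α * β - (n - 2) * β ^ 2) * gradSq h V (Fin.tail P))
    - ε * (Real.exp (2 * ((q (P 0) - β * V (Fin.tail P)) - (r (P 0) + α * V (Fin.tail P))))
      * h (Fin.tail P) i j) * (deriv (deriv q) (P 0) + n * deriv q (P 0) ^ 2
        - deriv r (P 0) * deriv q (P 0)) := by
  have hx := hP.2
  have hdiv := sum_pd_grad w.isOpen_snd w.metric w.smooth_V hx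
  have hu := fun i => sum_mul_grad w.metric hx (V := V) i
  have hs := w.metric.apply_comm hx
  have hΓ := w.metric.christoffel_comm w.isOpen_snd hx
  have hVV := pd_pd_comm w.isOpen_snd w.smooth_V hx
  have hquad := sum_sum_conformal_mul (fun k i j => christoffel h k i j (Fin.tail P))
    (fun i => pd i V (Fin.tail P)) (fun k => grad h V k (Fin.tail P)) (h (Fin.tail P)) hs hu β i j
  rw [ricci_eq_of_trace (w.trace_christoffel hP), ricci_eq h]
  simp only [Fin.sum_univ_succ (n := n), Fin.cons_zero, Fin.cons_succ, if_true, w.pd_zero_christoffel_zero_succ_succ hP,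
    w.pd_succ_christoffel_zero_succ_zero hP,
    w.pd_succ_christoffel_succ_succ_succ hP, w.christoffel_zero_succ_zero hP,
    w.christoffel_zero_succ_succ hP, 
    w.christoffel_succ_succ_zero hP, w.christoffel_succ_succ_succ hP]
  generalize Real.exp (2 * (q (P 0) - β * V (Fin.tail P) - (r (P 0) + α * V (Fin.tail P)))) = F
  have e1 : ∑ l, -(ε * (F * (deriv q (P 0) * h (Fin.tail P) j l))) *
      (if l = i then deriv q (P 0) else 0) =
      -(ε * F * deriv q (P 0) ^ 2 * h (Fin.tail P) i j) := by
    simp [hs j i]; ring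
  have e2 : ∑ k, (if k = j then deriv q (P 0) else 0) *
      -(ε * (F * (deriv q (P 0) * h (Fin.tail P) i k))) =
      -(ε * F * deriv q (P 0) ^ 2 * h (Fin.tail P) i j) := by
    simp; ring
  -- Metric compatibility along the gradient; these terms cancel the ΓΓ cross terms of
  -- `sum_sum_conformal_mul`.
  have e3 : ∀ a b, ∑ k, pd k (fun x => h x a b) (Fin.tail P) * grad h V k (Fin.tail P) =
      ∑ k, ∑ l, h (Fin.tail P) a k * (christoffel h k b l (Fin.tail P) * grad h V l (Fin.tail P))
      + ∑ k, ∑ l, h (Fin.tail P) b k *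
        (christoffel h k a l (Fin.tail P) * grad h V l (Fin.tail P)) := by
    intro a b
    simp only [w.metric.pd_eq w.isOpen_snd hx, add_mul, Finset.sum_add_distrib, Finset.sum_mul]
    congr 1 <;> rw [Finset.sum_comm] <;>
    exact Finset.sum_congr rfl fun k _ => Finset.sum_congr rfl fun l _ => by rw [hΓ k l]; ring
  have e4 : ∑ k, (pd k (christoffel h k i j) (Fin.tail P)
        - β * ((if k = i then 1 else 0) * pd k (pd j V) (Fin.tail P)
        + (if k = j then 1 else 0) * pd k (pd i V) (Fin.tail P)
        - (pd k (fun x => h x i j) (Fin.tail P) * grad h V k (Fin.tail P)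
          + h (Fin.tail P) i j * pd k (grad h V k) (Fin.tail P)))) =
      ∑ k, pd k (christoffel h k i j) (Fin.tail P) - β * (2 * pd i (pd j V) (Fin.tail P)
        - (∑ k, pd k (fun x => h x i j) (Fin.tail P) * grad h V k (Fin.tail P)
          + h (Fin.tail P) i j * ∑ k, pd k (grad h V k) (Fin.tail P))) := by
    simp only [Finset.sum_sub_distrib, ← Finset.mul_sum, Finset.sum_add_distrib, sum_delta_mul,
      hVV j i]
    ring
  -- The last bracket sums to ∂_j of h_{ik}(grad V)^k = ∂_i V. It cancels the first delta term, and
  -- the term with coefficient 1 is counted n times.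
  have e5 : ∑ k, (pd j (christoffel h k i k) (Fin.tail P)
        - β * ((if k = i then 1 else 0) * pd j (pd k V) (Fin.tail P)
        + 1 * pd j (pd i V) (Fin.tail P)
        - (pd j (fun x => h x i k) (Fin.tail P) * grad h V k (Fin.tail P)
          + h (Fin.tail P) i k * pd j (grad h V k) (Fin.tail P)))) =
      ∑ k, pd j (christoffel h k i k) (Fin.tail P) - β * (n * pd i (pd j V) (Fin.tail P)) := by
    have h1 : HasPD j (fun q => ∑ k, h q i k * grad h V k q)
        (∑ k, (pd j (fun q => h q i k) (Fin.tail P) * grad h V k (Fin.tail P)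
          + h (Fin.tail P) i k * pd j (grad h V k) (Fin.tail P))) (Fin.tail P) :=
      HasPD.sum fun k _ => (HasPD.of_differentiableAt (w.differentiableAt_h hP i k)).mul
        (w.hasPD_grad hP j k)
    have h2 : HasPD j (fun q => ∑ k, h q i k * grad h V k q) (pd j (pd i V) (Fin.tail P))
        (Fin.tail P) := by
      refine (w.hasPD_pd_V hP j i).congr_fun ?_
      filter_upwards [w.isOpen_snd.mem_nhds hx] with q hq using sum_mul_grad w.metric hq i
    simp only [Finset.sum_sub_distrib, ← Finset.mul_sum, Finset.sum_add_distrib (f := fun k =>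
      (if k = i then (1 : ℝ) else 0) * _), sum_delta_mul, h1.2.symm.trans h2.2]
    simp [hVV j i]
  have e6 : ∑ l, (∑ k, christoffel h k k l (Fin.tail P) + (α - n * β) * pd l V (Fin.tail P)) *
      (christoffel h l i j (Fin.tail P) - β * ((if l = i then 1 else 0) * pd j V (Fin.tail P)
        + (if l = j then 1 else 0) * pd i V (Fin.tail P)
        - h (Fin.tail P) i j * grad h V l (Fin.tail P))) =
      ∑ l, (∑ k, christoffel h k k l (Fin.tail P)) * christoffel h l i j (Fin.tail P)
      + (α - n * β) * ∑ l, christoffel h l i j (Fin.tail P) * pd l V (Fin.tail P)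
      - β * ((∑ k, christoffel h k k i (Fin.tail P)) * pd j V (Fin.tail P)
        + (∑ k, christoffel h k k j (Fin.tail P)) * pd i V (Fin.tail P)
        - h (Fin.tail P) i j *
          ∑ l, (∑ k, christoffel h k k l (Fin.tail P)) * grad h V l (Fin.tail P))
      - β * (α - n * β) * (2 * pd i V (Fin.tail P) * pd j V (Fin.tail P)
        - h (Fin.tail P) i j * gradSq h V (Fin.tail P)) := by
    calc _ = ∑ l, ((∑ k, christoffel h k k l (Fin.tail P)) * christoffel h l i j (Fin.tail P)
          + (α - n * β) * (christoffel h l i j (Fin.tail P) * pd l V (Fin.tail P))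
          - (if l = i then 1 else 0) * (β * pd j V (Fin.tail P) *
            (∑ k, christoffel h k k l (Fin.tail P) + (α - n * β) * pd l V (Fin.tail P)))
          - (if l = j then 1 else 0) * (β * pd i V (Fin.tail P) *
            (∑ k, christoffel h k k l (Fin.tail P) + (α - n * β) * pd l V (Fin.tail P)))
          + β * h (Fin.tail P) i j *
            ((∑ k, christoffel h k k l (Fin.tail P)) * grad h V l (Fin.tail P))
          + β * h (Fin.tail P) i j * (α - n * β) *
            (pd l V (Fin.tail P) * grad h V l (Fin.tail P))) :=
        Finset.sum_congr rfl fun l _ => by ring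
      _ = _ := by
        rw [Finset.sum_add_distrib, Finset.sum_add_distrib, Finset.sum_sub_distrib,
          Finset.sum_sub_distrib, Finset.sum_add_distrib, sum_delta_mul, sum_delta_mul,
          ← Finset.mul_sum, ← Finset.mul_sum, ← Finset.mul_sum, gradSq]
        ring
  have e7 : hessian h V i j (Fin.tail P) = pd i (pd j V) (Fin.tail P)
      - ∑ l, christoffel h l i j (Fin.tail P) * pd l V (Fin.tail P) := rfl
  have e8 : ∀ a, ∑ k, christoffel h k a k (Fin.tail P) = ∑ k, christoffel h k k a (Fin.tail P) :=
    fun a => Finset.sum_congr rfl fun k _ => hΓ k a k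
  have e9 : ∑ k, christoffel h k j i (Fin.tail P) * pd k V (Fin.tail P) =
      ∑ l, christoffel h l i j (Fin.tail P) * pd l V (Fin.tail P) :=
    Finset.sum_congr rfl fun k _ => by rw [hΓ k j i]
  simp only [Finset.sum_add_distrib (f := fun k : Fin n => (if k = j then deriv q (P 0) else 0) * _)]
  rw [e1, e2, e4, e5, e6, e7, hquad, e3, e8, e8, e9, hdiv, hVV j i]
  simp only [gradSq]
  ring

end IsWarpData

end

/-! ### The operator □ of a warped metric -/

section

namespace IsWarpData

variable {n : ℕ} {ε α β : ℝ} {I : Set ℝ} {Ω : Set (Fin n → ℝ)} {r q : ℝ → ℝ}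
  {V : (Fin n → ℝ) → ℝ} {h : (Fin n → ℝ) → Matrix (Fin n) (Fin n) ℝ} {P : Fin (n + 1) → ℝ}

section Box

variable {τ : ℝ → ℝ} (w : IsWarpData ε I Ω r q V h) (hτ : ContDiffOn ℝ ∞ τ I)
  (hP : P ∈ cylinder I Ω) (σ : ℝ)
include w hτ hP

theorem pd_zero_field :
    pd 0 (fun Q => σ * V (Fin.tail Q) + τ (Q 0)) P = deriv τ (P 0) :=
  (((HasPD.zero_tail (w.differentiableAt_V hP)).const_mul σ).add
    (HasPD.zero_zero (hasDerivAt_of_contDiffOn w.isOpen_fst hτ hP.1))).2.trans (by ring)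

theorem pd_succ_field (i : Fin n) :
    pd i.succ (fun Q => σ * V (Fin.tail Q) + τ (Q 0)) P = σ * pd i V (Fin.tail P) :=
  (((HasPD.succ_tail (w.hasPD_V hP i)).const_mul σ).add
    (HasPD.succ_zero (hasDerivAt_of_contDiffOn w.isOpen_fst hτ hP.1) i)).2.trans (by ring)

theorem pd_zero_pd_zero_field :
    pd 0 (pd 0 fun Q => σ * V (Fin.tail Q) + τ (Q 0)) P = deriv (deriv τ) (P 0) :=
  ((HasPD.zero_zero (hasDerivAt_deriv_of_contDiffOn w.isOpen_fst hτ hP.1)).congr_fun <| by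
    filter_upwards [w.mem_nhds hP] with Q hQ using w.pd_zero_field hτ hQ σ).2

theorem pd_succ_pd_succ_field (i j : Fin n) :
    pd i.succ (pd j.succ fun Q => σ * V (Fin.tail Q) + τ (Q 0)) P =
      σ * pd i (pd j V) (Fin.tail P) :=
  (((HasPD.succ_tail (w.hasPD_pd_V hP i j)).const_mul σ).congr_fun <| by
    filter_upwards [w.mem_nhds hP] with Q hQ using w.pd_succ_field hτ hQ σ j).2

/-- The coefficient of |∇V|² collects α from Γ^k_{00} and 2β - nβ from tracing the conformal part of
Γ^k_{ij}. -/
theorem box_warpMetric :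
    box (warpMetric ε r q α β V h) (fun Q => σ * V (Fin.tail Q) + τ (Q 0)) P =
      Real.exp (-(2 * (q (P 0) - β * V (Fin.tail P)))) *
        (σ * (box h V (Fin.tail P) + (α - (n - 2) * β) * gradSq h V (Fin.tail P)))
      + ε * Real.exp (-(2 * (r (P 0) + α * V (Fin.tail P)))) *
        (deriv (deriv τ) (P 0) - deriv r (P 0) * deriv τ (P 0)
          + n * (deriv q (P 0) * deriv τ (P 0))) := by
  have hx := hP.2
  -- With `hF`: multiplying g^{00} or g^{ij} by the exponential in the matching Christoffel symbol
  -- gives the other prefactor. Hence only two exponentials survive.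
  have hE : Real.exp (-(2 * (r (P 0) + α * V (Fin.tail P)))) *
      Real.exp (2 * ((r (P 0) + α * V (Fin.tail P)) - (q (P 0) - β * V (Fin.tail P)))) =
      Real.exp (-(2 * (q (P 0) - β * V (Fin.tail P)))) := by
    rw [← Real.exp_add]; congr 1; ring
  have hF : Real.exp (-(2 * (q (P 0) - β * V (Fin.tail P)))) *
      Real.exp (2 * ((q (P 0) - β * V (Fin.tail P)) - (r (P 0) + α * V (Fin.tail P)))) =
      Real.exp (-(2 * (r (P 0) + α * V (Fin.tail P)))) := by
    rw [← Real.exp_add]; congr 1; ring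
  have hS : gradSq h V (Fin.tail P) = ∑ i, ∑ j, (h (Fin.tail P))⁻¹ i j *
      (pd i V (Fin.tail P) * pd j V (Fin.tail P)) := by
    simp only [gradSq, grad, Finset.mul_sum]
    exact Finset.sum_congr rfl fun i _ => Finset.sum_congr rfl fun j _ => by ring
  have hn : ∑ i, ∑ j, (h (Fin.tail P))⁻¹ i j * h (Fin.tail P) i j = n := by
    have : ∀ i, ∑ j, (h (Fin.tail P))⁻¹ i j * h (Fin.tail P) i j = 1 := fun i => by
      rw [Finset.sum_congr rfl fun j _ => by rw [w.metric.apply_comm hx i j],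
        w.metric.sum_inv_mul hx, if_pos rfl]
    simp [this]
  have h0 : hessian (warpMetric ε r q α β V h) (fun Q => σ * V (Fin.tail Q) + τ (Q 0)) 0 0 P =
      deriv (deriv τ) (P 0) - deriv r (P 0) * deriv τ (P 0) +
      ε * Real.exp (2 * ((r (P 0) + α * V (Fin.tail P)) - (q (P 0) - β * V (Fin.tail P)))) *
        α * σ * gradSq h V (Fin.tail P) := by
    simp only [hessian, w.pd_zero_pd_zero_field hτ hP, Fin.sum_univ_succ (n := n),
      w.christoffel_zero_zero_zero hP, w.pd_zero_field hτ hP, w.pd_succ_field hτ hP,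
      w.christoffel_succ_zero_zero hP, gradSq, Finset.mul_sum]
    rw [← sub_sub, sub_eq_add_neg (_ - _), ← Finset.sum_neg_distrib]
    congr 1
    exact Finset.sum_congr rfl fun k _ => by ring
  have h1 : ∀ i j : Fin n, hessian (warpMetric ε r q α β V h)
      (fun Q => σ * V (Fin.tail Q) + τ (Q 0)) i.succ j.succ P = σ * hessian h V i j (Fin.tail P)
      + ε * Real.exp (2 * ((q (P 0) - β * V (Fin.tail P)) - (r (P 0) + α * V (Fin.tail P)))) *
        deriv q (P 0) * deriv τ (P 0) * h (Fin.tail P) i j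
      + 2 * σ * β * (pd i V (Fin.tail P) * pd j V (Fin.tail P))
      - σ * β * gradSq h V (Fin.tail P) * h (Fin.tail P) i j := by
    intro i j
    simp only [hessian, w.pd_succ_pd_succ_field hτ hP, Fin.sum_univ_succ (n := n),
      w.pd_zero_field hτ hP, w.pd_succ_field hτ hP, w.christoffel_zero_succ_succ hP,
      w.christoffel_succ_succ_succ hP]
    have : ∑ k, (christoffel h k i j (Fin.tail P) - β * ((if k = i then 1 else 0) *
        pd j V (Fin.tail P) + (if k = j then 1 else 0) * pd i V (Fin.tail P)
        - h (Fin.tail P) i j * grad h V k (Fin.tail P))) * (σ * pd k V (Fin.tail P)) =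
        σ * ∑ k, christoffel h k i j (Fin.tail P) * pd k V (Fin.tail P)
        - 2 * σ * β * (pd i V (Fin.tail P) * pd j V (Fin.tail P))
        + σ * β * gradSq h V (Fin.tail P) * h (Fin.tail P) i j := by
      calc _ = ∑ k, (σ * (christoffel h k i j (Fin.tail P) * pd k V (Fin.tail P))
            - (if k = i then 1 else 0) * (σ * β * pd j V (Fin.tail P) * pd k V (Fin.tail P))
            - (if k = j then 1 else 0) * (σ * β * pd i V (Fin.tail P) * pd k V (Fin.tail P))
            + σ * β * h (Fin.tail P) i j * (pd k V (Fin.tail P) * grad h V k (Fin.tail P))) :=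
          Finset.sum_congr rfl fun k _ => by ring
        _ = _ := by
          rw [Finset.sum_add_distrib, Finset.sum_sub_distrib, Finset.sum_sub_distrib,
            sum_delta_mul, sum_delta_mul, ← Finset.mul_sum, ← Finset.mul_sum, gradSq]
          ring
    rw [this]
    ring
  rw [box]
  simp only [w.inv_warpMetric hP, Fin.sum_univ_succ (n := n), blockMatrix_zero_zero,
    blockMatrix_zero_succ, blockMatrix_succ_zero, blockMatrix_succ_succ, zero_mul, zero_add,
    Finset.sum_const_zero, add_zero, h0, h1, Matrix.smul_apply, smul_eq_mul]
  generalize Real.exp (-(2 * (r (P 0) + α * V (Fin.tail P)))) = A at *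
  generalize Real.exp (-(2 * (q (P 0) - β * V (Fin.tail P)))) = B at *
  generalize Real.exp (2 * (r (P 0) + α * V (Fin.tail P) - (q (P 0) - β * V (Fin.tail P)))) = E
    at *
  generalize Real.exp (2 * (q (P 0) - β * V (Fin.tail P) - (r (P 0) + α * V (Fin.tail P)))) = F
    at *
  generalize gradSq h V (Fin.tail P) = S at *
  have hsum : ∑ i, ∑ j, B * (h (Fin.tail P))⁻¹ i j * (σ * hessian h V i j (Fin.tail P)
      + ε * F * deriv q (P 0) * deriv τ (P 0) * h (Fin.tail P) i j
      + 2 * σ * β * (pd i V (Fin.tail P) * pd j V (Fin.tail P))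
      - σ * β * S * h (Fin.tail P) i j) =
      B * σ * box h V (Fin.tail P) + B * (ε * F * deriv q (P 0) * deriv τ (P 0)
        - σ * β * S) * n + B * (2 * σ * β) * S := by
    calc _ = B * σ * ∑ i, ∑ j, (h (Fin.tail P))⁻¹ i j * hessian h V i j (Fin.tail P)
          + B * (ε * F * deriv q (P 0) * deriv τ (P 0) - σ * β * S)
            * (∑ i, ∑ j, (h (Fin.tail P))⁻¹ i j * h (Fin.tail P) i j)
          + B * (2 * σ * β) * ∑ i, ∑ j, (h (Fin.tail P))⁻¹ i j *
            (pd i V (Fin.tail P) * pd j V (Fin.tail P)) := by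
          simp only [Finset.mul_sum, ← Finset.sum_add_distrib]
          exact Finset.sum_congr rfl fun i _ => Finset.sum_congr rfl fun j _ => by ring
      _ = _ := by rw [hn, ← hS, box]
  rw [hsum]
  linear_combination (B * α * σ * S) * w.sq_eps + (ε * ε * α * σ * S) * hE +
    n * ε * deriv q (P 0) * deriv τ (P 0) * hF

end Box

end IsWarpData

end

section

variable {n : ℕ} {ε : ℝ} {Ω : Set (Fin n → ℝ)} {V : (Fin n → ℝ) → ℝ}
  {h : (Fin n → ℝ) → Matrix (Fin n) (Fin n) ℝ}

/-! ### Metrics derived from a vacuum seed -/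

theorem orthSymMetric_eq_warpMetric :
    orthSymMetric ε V h = warpMetric ε (fun _ => 0) (fun _ => 0) 1 1 V h := by
  funext P
  simp [orthSymMetric, warpMetric]

theorem inflatedMetric_eq_warpMetric (α δ : ℝ) (μ : ℝ → ℝ) :
    inflatedMetric ε V h α δ μ = warpMetric ε μ μ α (α + δ) V h := by
  funext P
  rw [inflatedMetric, orthSymMetric, warpMetric, smul_blockMatrix, smul_smul, smul_smul,
    ← Real.exp_add, ← Real.exp_add, mul_left_comm, ← Real.exp_add]
  congr 3
  · ring
  · ring_nf

theorem fonarevMetric_eq_warpMetric (N : ℕ) (lam η s : ℝ) :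
    fonarevMetric N ε V h lam η s = warpMetric ε (fun y => lam ^ 2 * √η * y) (fun y => √η * y)
      (alpha N lam s) (gamma N lam s) V h := by
  funext P
  rw [fonarevMetric, warpMetric]
  congr 3
  · ring
  · ring_nf

theorem IsVacuumSeed.isWarpData (hseed : IsVacuumSeed ε Ω V h) (hε : ε = 1 ∨ ε = -1)
    (hΩ : IsOpen Ω) {I : Set ℝ} (hI : IsOpen I) {r q : ℝ → ℝ} (hr : ContDiffOn ℝ ∞ r I)
    (hq : ContDiffOn ℝ ∞ q I) : IsWarpData ε I Ω r q V h where
  sq_eps := by rcases hε with rfl | rfl <;> norm_num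
  isOpen_fst := hI
  isOpen_snd := hΩ
  smooth_r := hr
  smooth_q := hq
  smooth_V := hseed.smooth
  metric := hseed.metric

section Seed

variable (hseed : IsVacuumSeed ε Ω V h) (hε : ε = 1 ∨ ε = -1) (hΩ : IsOpen Ω)
  {x : Fin n → ℝ} (hx : x ∈ Ω)
include hseed hε hΩ hx

/-- The yy component of the vacuum equation with α = β = 1. -/
theorem IsVacuumSeed.box_eq : box h V x = (n - 3) * gradSq h V x := by
  have w := hseed.isWarpData hε hΩ isOpen_univ (contDiffOn_const (c := 0))
    (contDiffOn_const (c := 0))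
  -- The seed metric does not depend on y, so the slice y = 0 suffices.
  have hP : (Fin.cons 0 x : Fin (n + 1) → ℝ) ∈ cylinder Set.univ Ω := ⟨trivial, by simpa⟩
  have h0 := hseed.vacuum _ hP 0 0
  rw [orthSymMetric_eq_warpMetric, w.ricci_zero_zero hP] at h0
  simp [w.eps_ne_zero] at h0
  linarith

/-- The spatial components of the vacuum equation; by `box_eq` their part proportional to `h`
vanishes. -/
theorem IsVacuumSeed.ricci_eq (i j : Fin n) : ricci h i j x =
    -(n - 3) * hessian h V i j x - (n - 5) * (pd i V x * pd j V x) := by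
  have w := hseed.isWarpData hε hΩ isOpen_univ (contDiffOn_const (c := 0))
    (contDiffOn_const (c := 0))
  have hP : (Fin.cons 0 x : Fin (n + 1) → ℝ) ∈ cylinder Set.univ Ω := ⟨trivial, by simpa⟩
  have h0 := hseed.vacuum _ hP i.succ j.succ
  rw [orthSymMetric_eq_warpMetric, w.ricci_succ_succ hP] at h0
  simp [hseed.box_eq hε hΩ hx] at h0
  linarith

end Seed

theorem deriv_fonarevPotential (N : ℕ) (κ ε lam η t : ℝ) :
    HasDerivAt (fonarevPotential N κ ε lam η)
      (-2 * (√(κ / ((N : ℝ) - 2)) * lam) * fonarevPotential N κ ε lam η t) t := by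
  have := (((hasDerivAt_id t).const_mul (-2 * (√(κ / ((N : ℝ) - 2)) * lam))).exp).const_mul
    (fonarevW0 N κ ε lam η)
  refine this.congr_deriv ?_
  simp [fonarevPotential]
  ring

theorem sqrt_div_mul_sqrt_div {a b : ℝ} (ha : 0 < a) (hb : 0 < b) : √(a / b) * √(b / a) = 1 := by
  rw [← Real.sqrt_mul (by positivity), div_mul_div_cancel₀ hb.ne', div_self ha.ne', Real.sqrt_one]

section Constants

variable {N : ℕ} (hN : 4 ≤ N) {lam s : ℝ} (hs : s = 1 ∨ s = -1)
include hN

theorem radicand_pos : 0 < (N : ℝ) - 3 + lam ^ 2 := by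
  have : (4 : ℝ) ≤ N := by exact_mod_cast hN
  nlinarith [sq_nonneg lam]

theorem gamma_relation (lam s : ℝ) :
    ((N : ℝ) - 3) * gamma N lam s = alpha N lam s + (N - 4) := by
  have : (4 : ℝ) ≤ N := by exact_mod_cast hN
  have h3 : (N : ℝ) - 3 ≠ 0 := by linarith
  rw [gamma, delta]
  field_simp
  ring

include hs

theorem alpha_sq : alpha N lam s ^ 2 * ((N : ℝ) - 3 + lam ^ 2) = lam ^ 2 := by
  have h := radicand_pos hN (lam := lam)
  rw [alpha, div_pow, Real.sq_sqrt h.le, div_mul_cancel₀ _ h.ne']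
  rcases hs with rfl | rfl <;> ring

end Constants

theorem exp_two_mul_mul_exp_neg (a b : ℝ) :
    Real.exp (2 * a) * Real.exp (-(2 * b)) = Real.exp (2 * (a - b)) := by
  rw [← Real.exp_add]; congr 1; ring

/-- The warped metric with Fonarev exponents over a vacuum seed solves the Einstein-scalar
equations if its `y`-dependent factors satisfy a Friedmann type equation. -/
theorem IsVacuumSeed.isEinsteinScalarSolution (hseed : IsVacuumSeed ε Ω V h)
    (hε : ε = 1 ∨ ε = -1) (hΩ : IsOpen Ω) (hn : 4 ≤ n + 1) {κ : ℝ} (hκ : 0 < κ) {I : Set ℝ}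
    (hI : IsOpen I) {r q : ℝ → ℝ} (hr : ContDiffOn ℝ ∞ r I) (hq : ContDiffOn ℝ ∞ q I)
    {lam η s : ℝ} (hs : s = 1 ∨ s = -1)
    (hqq : ∀ y ∈ I, deriv (deriv q) y - deriv r y * deriv q y = -lam ^ 2 * deriv q y ^ 2)
    (hη : ∀ y ∈ I, deriv q y ^ 2 = η * Real.exp (2 * (r y - lam ^ 2 * q y))) :
    IsEinsteinScalarSolution κ (cylinder I Ω)
      (warpMetric ε r q (alpha (n + 1) lam s) (gamma (n + 1) lam s) V h)
      (fun Q => √((((n + 1 : ℕ) : ℝ) - 2) / κ) * (s * (1 / √(((n + 1 : ℕ) : ℝ) - 3 + lam ^ 2)))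
        * V (Fin.tail Q) + √((((n + 1 : ℕ) : ℝ) - 2) / κ) * lam * q (Q 0))
      (fonarevPotential (n + 1) κ ε lam η) := by
  have w := hseed.isWarpData hε hΩ hI hr hq
  have hn3 : (3 : ℝ) ≤ n := by exact_mod_cast (by omega : 3 ≤ n)
  have hR := radicand_pos hn (lam := lam)
  have hL := Real.sqrt_pos.2 hR
  have hLsq := Real.sq_sqrt hR.le
  have hγ := gamma_relation hn lam s
  have hα := alpha_sq hn hs (lam := lam)
  have hαL : alpha (n + 1) lam s = s * (1 / √(((n + 1 : ℕ) : ℝ) - 3 + lam ^ 2)) * lam := by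
    rw [alpha]; ring
  have hss : s ^ 2 = 1 := by rcases hs with rfl | rfl <;> norm_num
  have hm : √((((n + 1 : ℕ) : ℝ) - 2) / κ) ^ 2 = (n - 1) / κ := by
    rw [Real.sq_sqrt]
    · push_cast; ring
    · push_cast; exact div_nonneg (by linarith) hκ.le
  have hkm : √(κ / (((n + 1 : ℕ) : ℝ) - 2)) * √((((n + 1 : ℕ) : ℝ) - 2) / κ) = 1 :=
    sqrt_div_mul_sqrt_div hκ (by push_cast; linarith)
  have hσ : (s * (1 / √(((n + 1 : ℕ) : ℝ) - 3 + lam ^ 2))) ^ 2 * (n - 2 + lam ^ 2) = 1 := by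
    rw [mul_pow, hss, div_pow, hLsq, one_pow, one_mul]
    push_cast at hR ⊢
    field_simp
    ring
  set α := alpha (n + 1) lam s
  set γ := gamma (n + 1) lam s
  set m := √((((n + 1 : ℕ) : ℝ) - 2) / κ)
  set k := √(κ / (((n + 1 : ℕ) : ℝ) - 2))
  set u := s * (1 / √(((n + 1 : ℕ) : ℝ) - 3 + lam ^ 2))
  push_cast at hγ hα
  have hτ : ContDiffOn ℝ ∞ (fun y => m * lam * q y) I := contDiffOn_const.mul hq
  have hτ1 : ∀ y ∈ I, deriv (fun y => m * lam * q y) y = m * lam * deriv q y := fun y hy =>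
    ((hasDerivAt_of_contDiffOn hI hq hy).const_mul _).deriv
  have hτ2 : ∀ y ∈ I, deriv (deriv fun y => m * lam * q y) y = m * lam * deriv (deriv q) y := by
    intro y hy
    have : deriv (fun y => m * lam * q y) =ᶠ[nhds y] fun y => m * lam * deriv q y := by
      filter_upwards [hI.mem_nhds hy] with z hz using hτ1 z hz
    rw [this.deriv_eq]
    exact ((hasDerivAt_deriv_of_contDiffOn hI hq hy).const_mul _).deriv
  -- Since km = 1 and α = uλ, the exponent -2kφ is -2λ²q - 2αV, and the Friedmann equation trades η
  -- e^{-2λ²q} for q'² e^{-2r}.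
  have hW : ∀ P ∈ cylinder I Ω, fonarevPotential (n + 1) κ ε lam η
      (m * u * V (Fin.tail P) + m * lam * q (P 0)) = -ε * ((n - 1) / (2 * κ)) * (n - lam ^ 2) *
        (deriv q (P 0) ^ 2 * Real.exp (-(2 * (r (P 0) + α * V (Fin.tail P))))) := by
    intro P hP
    have he : -2 * (k * lam) * (m * u * V (Fin.tail P) + m * lam * q (P 0)) =
        2 * (r (P 0) - lam ^ 2 * q (P 0)) + -(2 * (r (P 0) + α * V (Fin.tail P))) := by
      rw [hαL]
      linear_combination (-2 * lam * (u * V (Fin.tail P) + lam * q (P 0))) * hkm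
    change fonarevW0 (n + 1) κ ε lam η *
      Real.exp (-2 * (k * lam) * (m * u * V (Fin.tail P) + m * lam * q (P 0))) = _
    rw [he, Real.exp_add, hη _ hP.1, fonarevW0]
    push_cast
    ring
  have hD : (n - 2) * ((n - 2) * γ ^ 2 - α ^ 2 - 2 * α * γ - (n - 5)) = (n - 1) * (1 - α ^ 2) := by
    have : (n - 2) * γ = α + (n - 3) := by linarith
    linear_combination ((n - 2) * γ - 2 * α + (α + (n - 3))) * this
  -- The coefficient t of dV⊗dV vanishes: multiplied by n-2, both sides equal (n-1)(1-α²), because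
  -- 1-α² = (n-2)u².
  have hD' : (n - 2) * γ ^ 2 - α ^ 2 - 2 * α * γ - (n - 5) = κ * (m * u) ^ 2 := by
    have h1 : 1 - α ^ 2 = (n - 2) * u ^ 2 := by rw [hαL]; linear_combination -hσ
    have h2 : κ * (m * u) ^ 2 = (n - 1) * u ^ 2 := by
      rw [mul_pow, hm]; field_simp
    have h3 : (n : ℝ) - 2 ≠ 0 := by linarith
    rw [h2]
    refine mul_left_cancel₀ h3 ?_
    rw [hD, h1]; ring
  have hκm : κ * m ^ 2 = n - 1 := by rw [hm]; field_simp
  have hn1 : (n : ℝ) - 1 ≠ 0 := by linarith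
  -- The choice of γ: this constant c multiplies the Hessian and all |∇V|² terms in the equations
  -- below.
  have hc : (n - 2) * γ - α - (n - 3) = 0 := by linarith
  have hN2 : ((n + 1 : ℕ) : ℝ) - 2 = n - 1 := by push_cast; ring
  have hfac : κ * (2 / ((n : ℝ) - 1)) * ((n - 1) / (2 * κ)) = 1 := by field_simp
  refine ⟨w.isMetricOn, ?_, fun P hP => (deriv_fonarevPotential ..).differentiableAt, ?_, ?_⟩
  · exact (contDiffOn_const.mul (contDiffOn_comp_tail hseed.smooth)).add
      (contDiffOn_const.mul (contDiffOn_comp_zero hq))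
  · intro P hP i j
    have hEE : Real.exp (2 * (r (P 0) + α * V (Fin.tail P))) *
        Real.exp (-(2 * (r (P 0) + α * V (Fin.tail P)))) = 1 := by rw [← Real.exp_add]; simp
    have hFE := exp_two_mul_mul_exp_neg (q (P 0) - γ * V (Fin.tail P))
      (r (P 0) + α * V (Fin.tail P))
    have hp0 := (w.pd_zero_field hτ hP (m * u)).trans (hτ1 _ hP.1)
    have hps := w.pd_succ_field hτ hP (m * u)
    beta_reduce at hp0 hps
    have hq2 := hqq _ hP.1
    rw [hW P hP, hN2]
    refine Fin.cases ?_ (fun i => ?_) i <;> refine Fin.cases ?_ (fun j => ?_) j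
    · rw [w.ricci_zero_zero hP, hp0, hseed.box_eq hε hΩ hP.2, warpMetric, blockMatrix_zero_zero]
      generalize Real.exp (2 * (r (P 0) + α * V (Fin.tail P))) = E at *
      generalize Real.exp (-(2 * (r (P 0) + α * V (Fin.tail P)))) = E' at *
      generalize Real.exp (2 * (r (P 0) + α * V (Fin.tail P) - (q (P 0) - γ * V (Fin.tail P)))) = F
      generalize gradSq h V (Fin.tail P) = S
      linear_combination (ε * F * α * S) * hc - n * hq2
        - lam ^ 2 * deriv q (P 0) ^ 2 * hκm
        + (ε * ε * E * E' * (n - lam ^ 2) * deriv q (P 0) ^ 2) * hfac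
        + (E * E' * (n - lam ^ 2) * deriv q (P 0) ^ 2) * w.sq_eps
        + ((n - lam ^ 2) * deriv q (P 0) ^ 2) * hEE
    · rw [w.ricci_zero_succ hP, hp0, hps, warpMetric, blockMatrix_zero_succ, hαL]
      linear_combination -(u * lam * deriv q (P 0) * pd j V (Fin.tail P)) * hκm
    · rw [w.ricci_succ_zero hP, hp0, hps, warpMetric, blockMatrix_succ_zero, hαL]
      linear_combination -(u * lam * deriv q (P 0) * pd i V (Fin.tail P)) * hκm
    · rw [w.ricci_succ_succ hP, hps, hps, hseed.box_eq hε hΩ hP.2, hseed.ricci_eq hε hΩ hP.2,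
        warpMetric, blockMatrix_succ_succ, Matrix.smul_apply, smul_eq_mul, ← hFE]
      generalize Real.exp (-(2 * (r (P 0) + α * V (Fin.tail P)))) = E'
      generalize Real.exp (2 * (q (P 0) - γ * V (Fin.tail P))) = F
      generalize gradSq h V (Fin.tail P) = S
      linear_combination (hessian h V i j (Fin.tail P) - h (Fin.tail P) i j * γ * S) * hc
        + pd i V (Fin.tail P) * pd j V (Fin.tail P) * hD'
        - ε * F * E' * h (Fin.tail P) i j * hq2
        + (ε * F * E' * h (Fin.tail P) i j * (n - lam ^ 2) * deriv q (P 0) ^ 2) * hfac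
  · intro P hP
    have hq2 := hqq _ hP.1
    have hkk : κ * m = (n - 1) * k := by
      linear_combination (κ * m) * (-hkm) + k * hκm
    rw [(deriv_fonarevPotential ..).deriv, hW P hP]
    refine (w.box_warpMetric hτ hP (m * u)).trans ?_
    rw [hτ1 _ hP.1, hτ2 _ hP.1, hseed.box_eq hε hΩ hP.2]
    change _ = -2 * (k * lam) * _
    generalize Real.exp (-(2 * (r (P 0) + α * V (Fin.tail P)))) = E'
    generalize Real.exp (-(2 * (q (P 0) - γ * V (Fin.tail P)))) = F
    generalize gradSq h V (Fin.tail P) = S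
    have h4 : m = k * ((n - 1) / κ) := by field_simp; linarith
    have h5 : deriv (deriv q) (P 0) - deriv r (P 0) * deriv q (P 0) + n * deriv q (P 0) ^ 2 =
      (n - lam ^ 2) * deriv q (P 0) ^ 2 := by linear_combination hq2
    have h6 : -2 * (k * lam) * (-ε * ((n - 1) / (2 * κ)) * (n - lam ^ 2) *
        (deriv q (P 0) ^ 2 * E')) = ε * E' * m * lam * ((n - lam ^ 2) * deriv q (P 0) ^ 2) := by
      rw [h4]; field_simp
    rw [h6, ← h5]
    linear_combination -(F * m * u * S) * hc

end

section

/-! ### Coordinate changes -/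

section Pullback

variable {n : ℕ} {ε : ℝ} {V : (Fin n → ℝ) → ℝ} {h : (Fin n → ℝ) → Matrix (Fin n) (Fin n) ℝ}

theorem pullback_warpMetric {Y : ℝ → ℝ} {Y' : ℝ} {P : Fin (n + 1) → ℝ}
    (hY : HasDerivAt Y Y' (P 0)) (r q : ℝ → ℝ) (α β : ℝ) :
    pullback (changeY Y) (warpMetric ε r q α β V h) P =
      blockMatrix (Y' ^ 2 * (ε * Real.exp (2 * (r (Y (P 0)) + α * V (Fin.tail P)))))
        (Real.exp (2 * (q (Y (P 0)) - β * V (Fin.tail P))) • h (Fin.tail P)) := by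
  have h00 : pd 0 (fun Q => changeY (n := n) Y Q 0) P = Y' := (HasPD.zero_zero hY).2
  have hs0 : ∀ i : Fin n, pd i.succ (fun Q => changeY (n := n) Y Q 0) P = 0 := fun i =>
    (HasPD.succ_zero hY i).2
  have hd : ∀ k, DifferentiableAt ℝ (fun x : Fin n → ℝ => x k) (Fin.tail P) := fun k =>
    differentiableAt_apply k _
  have h0s : ∀ k : Fin n, pd 0 (fun Q => changeY (n := n) Y Q k.succ) P = 0 := fun k =>
    (HasPD.zero_tail (hd k)).2
  have hss : ∀ i k : Fin n, pd i.succ (fun Q => changeY (n := n) Y Q k.succ) P =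
      if k = i then 1 else 0 := fun i k => by
    refine (HasPD.succ_tail (HasPD.of_differentiableAt (hd k))).2.trans ?_
    have : HasFDerivAt (fun x : Fin n → ℝ => x k) _ (Fin.tail P) := hasFDerivAt_apply (𝕜 := ℝ) k _
    rw [pd, this.fderiv]
    simp [Pi.single_apply]
  have ht : Fin.tail (changeY Y P) = Fin.tail P := Fin.tail_cons _ _
  have h0 : changeY Y P 0 = Y (P 0) := rfl
  ext a b
  refine Fin.cases ?_ (fun a => ?_) a <;> refine Fin.cases ?_ (fun b => ?_) b <;>
    simp [pullback, Fin.sum_univ_succ (n := n), h00, hs0, h0s, hss, warpMetric, ht, h0]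
  exact Or.inl (sq Y').symm

/-- Every first order equation `Y' = e^{-cY}` has a solution mapping an open interval
onto the line. -/
theorem exists_coordinate (c : ℝ) : ∃ (I : Set ℝ) (Y : ℝ → ℝ), IsOpen I ∧ I.OrdConnected ∧
    ContDiffOn ℝ ∞ Y I ∧ (∀ y ∈ I, HasDerivAt Y (Real.exp (-c * Y y)) y) ∧ Set.InjOn Y I ∧
    Y '' I = Set.univ := by
  rcases eq_or_ne c 0 with rfl | hc
  · exact ⟨Set.univ, id, isOpen_univ, Set.ordConnected_univ, contDiff_id.contDiffOn,
      fun y _ => by simpa using hasDerivAt_id y, Set.injOn_id _, by simp⟩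
  -- Separation of variables gives e^{cY} = cy. On the half-line cy > 0 the solution runs over all
  -- of the real line.
  · refine ⟨{y | 0 < c * y}, fun y => Real.log (c * y) / c,
      isOpen_lt continuous_const (continuous_const.mul continuous_id), ?_, ?_, ?_, ?_, ?_⟩
    · have : Convex ℝ {y : ℝ | 0 < c * y} :=
        convex_halfSpace_gt (f := fun y => c * y) (IsLinearMap.isLinearMap_smul c) 0
      exact this.ordConnected
    · exact ((contDiffOn_const.mul contDiff_id.contDiffOn).log fun y hy =>
        (ne_of_gt hy)).div_const c
    · intro y hy
      have hy' : 0 < c * y := hy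
      have h1 := (((hasDerivAt_id y).const_mul c).log hy'.ne').div_const c
      refine h1.congr_deriv ?_
      rw [neg_mul, mul_div_cancel₀ _ hc, Real.exp_neg, Real.exp_log hy']
      simp
      field_simp
    · intro y hy z hz hyz
      have hl : Real.log (c * y) = Real.log (c * z) := by
        have : Real.log (c * y) / c = Real.log (c * z) / c := hyz
        field_simp at this
        exact this
      exact mul_left_cancel₀ hc (Real.log_injOn_pos hy hz hl)
    · refine Set.eq_univ_of_forall fun t => ⟨Real.exp (c * t) / c, ?_, ?_⟩
      · change 0 < c * (Real.exp (c * t) / c)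
        rw [mul_div_cancel₀ _ hc]
        exact Real.exp_pos _
      · simp only [mul_div_cancel₀ _ hc, Real.log_exp]
        field_simp

end Pullback

/-! ### Nonconstant functions have nonzero derivatives -/

theorem exists_pd_ne_zero {m : ℕ} {D : Set (Fin m → ℝ)} {V : (Fin m → ℝ) → ℝ} (hD : IsOpen D)
    (hc : IsPreconnected D) (hV : ContDiffOn ℝ ∞ V D) (hn : ¬ ∃ c, ∀ x ∈ D, V x = c) :
    ∃ x ∈ D, ∃ i, pd i V x ≠ 0 := by
  by_contra! hcon
  refine hn ?_
  obtain ⟨c, hc⟩ := hD.exists_is_const_of_fderiv_eq_zero (𝕜 := ℝ) hc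
    (hV.differentiableOn (by simp)) (fun x hx => by
      ext v
      rw [pi_eq_sum_univ v]
      simp only [map_sum, map_smul]
      refine (Finset.sum_eq_zero fun i _ => ?_).trans (by simp)
      have := hcon x hx i
      rw [pd] at this
      have he : (fun j => if i = j then (1 : ℝ) else 0) = Pi.single i 1 := by
        ext j; simp [Pi.single_apply, eq_comm]
      rw [he, this, smul_zero])
  exact ⟨c, fun x hx => hc x hx⟩

theorem const_of_deriv_eq_zero {I : Set ℝ} {f : ℝ → ℝ} (hI : IsOpen I) (hc : I.OrdConnected)
    (hf : ContDiffOn ℝ ∞ f I) (h : ∀ y ∈ I, deriv f y = 0) : ∃ c, ∀ y ∈ I, f y = c := by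
  obtain ⟨c, hc⟩ := hI.exists_is_const_of_deriv_eq_zero hc.isPreconnected
    (hf.differentiableOn (by simp)) (fun y hy => h y hy)
  exact ⟨c, fun x hx => hc x hx⟩

/-- Solutions of `μ'' = a μ'²` satisfy `μ' = C e^{aμ}`. -/
theorem exists_deriv_eq_mul_exp {I : Set ℝ} {μ : ℝ → ℝ} {a : ℝ} (hI : IsOpen I)
    (hc : I.OrdConnected) (hμ : ContDiffOn ℝ ∞ μ I)
    (h : ∀ y ∈ I, deriv (deriv μ) y = a * deriv μ y ^ 2) :
    ∃ C, ∀ y ∈ I, deriv μ y = C * Real.exp (a * μ y) := by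
  have hμ' := ((contDiffOn_infty_iff_deriv_of_isOpen hI).1 hμ).2
  -- The first integral is μ' e^{-aμ}.
  obtain ⟨C, hC⟩ := const_of_deriv_eq_zero (f := fun y => deriv μ y * Real.exp (-(a * μ y)))
    hI hc (hμ'.mul (contDiffOn_const.mul hμ).neg.exp) fun y hy => by
      have h1 := hasDerivAt_of_contDiffOn hI hμ hy
      have h2 := hasDerivAt_deriv_of_contDiffOn hI hμ hy
      refine (h2.mul (h1.const_mul a).neg.exp).deriv.trans ?_
      rw [h y hy]
      ring
  refine ⟨C, fun y hy => ?_⟩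
  rw [← hC y hy, mul_assoc, ← Real.exp_add]
  simp

/-- A nondegenerate quadratic form of rank at least two is not a multiple of a square. -/
theorem eq_zero_of_mul_eq_mul {n : ℕ} (hn : 2 ≤ n) {B : Matrix (Fin n) (Fin n) ℝ}
    (hB : B.det ≠ 0) {v : Fin n → ℝ} {t f : ℝ} (h : ∀ i j, t * (v i * v j) = f * B i j) :
    f = 0 := by
  by_contra hf
  have : Nontrivial (Fin n) := Fin.nontrivial_iff_two_le.2 hn
  refine hB ?_
  -- If f were nonzero, `B` would have rank at most one and hence determinant zero.
  have hv : B = Matrix.vecMulVec ((t / f) • v) v := by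
    ext i j
    rw [Matrix.vecMulVec_apply, Pi.smul_apply, smul_eq_mul]
    have := h i j
    field_simp
    linarith
  rw [hv, Matrix.det_vecMulVec]

/-- Used to read off the conformal factor from an equality between multiples of the same metric. -/
theorem exists_apply_ne_zero {n : ℕ} (hn : 1 ≤ n) {B : Matrix (Fin n) (Fin n) ℝ}
    (hB : B.det ≠ 0) : ∃ i j, B i j ≠ 0 := by
  by_contra! hcon
  have : B = 0 := by ext i j; exact hcon i j
  have : Nonempty (Fin n) := ⟨⟨0, hn⟩⟩
  exact hB (by simp [‹B = 0›])

end

/-! ### The family consists of solutions and lies in the class -/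

section

variable {n : ℕ} {ε κ : ℝ} {Ω : Set (Fin n → ℝ)} {V : (Fin n → ℝ) → ℝ}
  {h : (Fin n → ℝ) → Matrix (Fin n) (Fin n) ℝ}

section Direct

variable (hseed : IsVacuumSeed ε Ω V h) (hε : ε = 1 ∨ ε = -1) (hΩ : IsOpen Ω) (hn : 4 ≤ n + 1)
  (hκ : 0 < κ) {lam η s : ℝ} (hη : 0 < η) (hs : s = 1 ∨ s = -1)
include hseed hε hΩ hn hκ hη hs

/-- With q = √η y and r = λ²q the Friedmann conditions are immediate: q'' = 0, r'q' = λ²q'², and q'²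
= η with exponent zero. -/
theorem IsVacuumSeed.fonarev_isSolution :
    IsEinsteinScalarSolution κ (cylinder Set.univ Ω) (fonarevMetric (n + 1) ε V h lam η s)
      (fonarevField (n + 1) κ V lam η s) (fonarevPotential (n + 1) κ ε lam η) := by
  have hlin : ∀ c : ℝ, ContDiffOn ℝ ∞ (fun y : ℝ => c * y) Set.univ := fun c =>
    contDiffOn_const.mul contDiffOn_id
  have hd : ∀ c : ℝ, deriv (fun y : ℝ => c * y) = fun _ => c := fun c => by
    funext y
    simp
  have key := hseed.isEinsteinScalarSolution hε hΩ hn hκ isOpen_univ (hlin (lam ^ 2 * √η))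
    (hlin √η) hs (lam := lam) (η := η) (fun y _ => by simp [hd]; ring) (fun y _ => by
      rw [hd, Real.sq_sqrt hη.le]
      ring_nf
      simp)
  rw [fonarevMetric_eq_warpMetric]
  convert key using 1
  funext Q
  rw [fonarevField]
  ring

theorem IsVacuumSeed.fonarev_mem_class (hΩn : Ω.Nonempty) (hlam : lam ^ 2 ≠ ((n + 1 : ℕ) : ℝ) - 1) :
    ∃ (I : Set ℝ) (μ : ℝ → ℝ) (α δ σ ρ : ℝ) (Y : ℝ → ℝ),
      α = alpha (n + 1) lam s ∧ δ = delta (n + 1) α ∧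
      IsInflatedSolution κ ε Ω V h I μ α δ σ ρ (fonarevPotential (n + 1) κ ε lam η) ∧
      Y '' I = Set.univ ∧
      IsFonarevIn (n + 1) κ ε Ω V h I (inflatedMetric ε V h α δ μ) (inflatedField V σ ρ μ)
        (fonarevPotential (n + 1) κ ε lam η) lam η s Y := by
  -- The class needs equal y-dependent factors in both blocks, that is Y' e^{λ²√η Y} = e^{√η Y};
  -- this fixes the constant.
  obtain ⟨I, Y, hI, hIc, hY, hY', hinj, him⟩ := exists_coordinate ((lam ^ 2 - 1) * √η)
  have hη' := Real.sqrt_pos.2 hη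
  have hηs := Real.sq_sqrt hη.le
  have hμ : ContDiffOn ℝ ∞ (fun y => √η * Y y) I := contDiffOn_const.mul hY
  have h1 : ∀ y ∈ I, deriv (fun y => √η * Y y) y =
      √η * Real.exp (-((lam ^ 2 - 1) * √η) * Y y) := fun y hy => ((hY' y hy).const_mul _).deriv
  have h2 : ∀ y ∈ I, deriv (deriv fun y => √η * Y y) y =
      √η * (Real.exp (-((lam ^ 2 - 1) * √η) * Y y) * (-((lam ^ 2 - 1) * √η) *
        Real.exp (-((lam ^ 2 - 1) * √η) * Y y))) := by
    intro y hy
    have : deriv (fun y => √η * Y y) =ᶠ[nhds y]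
        fun y => √η * Real.exp (-((lam ^ 2 - 1) * √η) * Y y) := by
      filter_upwards [hI.mem_nhds hy] with z hz using h1 z hz
    rw [this.deriv_eq]
    exact ((((hY' y hy).const_mul _).exp).const_mul _).deriv
  have key := hseed.isEinsteinScalarSolution hε hΩ hn hκ hI hμ hμ hs (lam := lam) (η := η)
    (fun y hy => by rw [h1 y hy, h2 y hy]; ring) (fun y hy => by
      rw [h1 y hy, mul_pow, hηs, ← Real.exp_nat_mul]
      congr 2
      push_cast
      ring)
  have hne : ∃ y, y ∈ I := by
    obtain ⟨y, hy, -⟩ : (0 : ℝ) ∈ Y '' I := him ▸ Set.mem_univ _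
    exact ⟨y, hy⟩
  have hsq : alpha (n + 1) lam s + delta (n + 1) (alpha (n + 1) lam s) = gamma (n + 1) lam s := rfl
  refine ⟨I, fun y => √η * Y y, alpha (n + 1) lam s, _,
    √((((n + 1 : ℕ) : ℝ) - 2) / κ) * (s * (1 / √(((n + 1 : ℕ) : ℝ) - 3 + lam ^ 2))),
    √((((n + 1 : ℕ) : ℝ) - 2) / κ) * lam, Y, rfl, rfl,
    ⟨hI, hIc, hμ, ?_, ?_, ?_⟩, him, ⟨⟨hY, fun y hy => ?_, hinj⟩, fun P hP => ?_,
      fun P hP => ?_, fun P hP => rfl⟩⟩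
  -- Y takes the values 0 and 1, so μ = √η Y is not constant.
  · rintro ⟨c, hc⟩
    obtain ⟨y, hy, hy0⟩ : (0 : ℝ) ∈ Y '' I := him ▸ Set.mem_univ _
    obtain ⟨z, hz, hz0⟩ : (1 : ℝ) ∈ Y '' I := him ▸ Set.mem_univ _
    have := (hc y hy).trans (hc z hz).symm
    rw [hy0, hz0] at this
    linarith
  · rw [inflatedMetric_eq_warpMetric, hsq]
    exact key
  · obtain ⟨y, hy⟩ := hne
    obtain ⟨x, hx⟩ := hΩn
    refine ⟨Fin.cons y x, ⟨hy, by simpa⟩, mul_ne_zero ?_ (Real.exp_ne_zero _)⟩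
    have hn3 : (3 : ℝ) ≤ n := by exact_mod_cast (by omega : 3 ≤ n)
    have hε0 : ε ≠ 0 := by rcases hε with rfl | rfl <;> norm_num
    refine mul_ne_zero (mul_ne_zero (mul_ne_zero (neg_ne_zero.2 hε0) (div_ne_zero ?_ ?_))
      (sub_ne_zero.2 hlam.symm)) hη.ne'
    · push_cast; linarith
    · positivity
  · rw [(hY' y hy).deriv]
    exact Real.exp_ne_zero _
  · rw [inflatedMetric_eq_warpMetric, fonarevMetric_eq_warpMetric,
      pullback_warpMetric (hY' _ hP.1), hsq, warpMetric, mul_left_comm, ← Real.exp_nat_mul,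
      ← Real.exp_add]
    congr 3
    push_cast
    ring
  · change _ = fonarevField (n + 1) κ V lam η s (Fin.cons _ _)
    simp only [fonarevField, inflatedField, Fin.tail_cons, Fin.cons_zero]
    ring

end Direct

theorem fonarevW0_ne_zero_iff (hε : ε = 1 ∨ ε = -1) {N : ℕ} (hN : 4 ≤ N) (hκ : 0 < κ)
    {lam η : ℝ} (hη : 0 < η) : fonarevW0 N κ ε lam η ≠ 0 ↔ lam ^ 2 ≠ (N : ℝ) - 1 := by
  have h4 : (4 : ℝ) ≤ N := by exact_mod_cast hN
  have hε0 : ε ≠ 0 := by rcases hε with rfl | rfl <;> norm_num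
  have h2 : ((N : ℝ) - 2) / (2 * κ) ≠ 0 := div_ne_zero (by linarith) (by positivity)
  rw [fonarevW0, not_iff_not]
  simp only [mul_eq_zero, neg_eq_zero, hε0, h2, hη.ne', false_or, or_false, sub_eq_zero]
  exact eq_comm

end

/-! ### Field equations of an inflated solution and their reduction -/

section

variable {n : ℕ} {ε κ : ℝ} {Ω : Set (Fin n → ℝ)} {V : (Fin n → ℝ) → ℝ}
  {h : (Fin n → ℝ) → Matrix (Fin n) (Fin n) ℝ} {I : Set ℝ} {μ : ℝ → ℝ} {α δ σ ρ : ℝ} {W : ℝ → ℝ}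

theorem pd_eq_zero_of_eq_zero {m : ℕ} {D : Set (Fin m → ℝ)} {f : (Fin m → ℝ) → ℝ} (hD : IsOpen D)
    (hf : ∀ x ∈ D, f x = 0) (i : Fin m) {x : Fin m → ℝ} (hx : x ∈ D) : pd i f x = 0 := by
  have : f =ᶠ[nhds x] fun _ => 0 := by
    filter_upwards [hD.mem_nhds hx] with y hy using hf y hy
  rw [pd, this.fderiv_eq]
  simp

theorem hessian_eq_zero_of_eq_zero {m : ℕ} {D : Set (Fin m → ℝ)} {f : (Fin m → ℝ) → ℝ}
    (hD : IsOpen D) (hf : ∀ x ∈ D, f x = 0) (g : (Fin m → ℝ) → Matrix (Fin m) (Fin m) ℝ)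
    (i j : Fin m) {x : Fin m → ℝ} (hx : x ∈ D) : hessian g f i j x = 0 := by
  rw [hessian, pd_eq_zero_of_eq_zero hD (fun y hy => pd_eq_zero_of_eq_zero hD hf j hy) i hx]
  simp [pd_eq_zero_of_eq_zero hD hf _ hx]

theorem gradSq_eq_zero_of_eq_zero {m : ℕ} {D : Set (Fin m → ℝ)} {f : (Fin m → ℝ) → ℝ}
    (hD : IsOpen D) (hf : ∀ x ∈ D, f x = 0) (g : (Fin m → ℝ) → Matrix (Fin m) (Fin m) ℝ)
    {x : Fin m → ℝ} (hx : x ∈ D) : gradSq g f x = 0 := by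
  simp [gradSq, pd_eq_zero_of_eq_zero hD hf _ hx]

section Equations

variable (hseed : IsVacuumSeed ε Ω V h) (hε : ε = 1 ∨ ε = -1) (hΩ : IsOpen Ω)
  (hsol : IsInflatedSolution κ ε Ω V h I μ α δ σ ρ W)
  {P : Fin (n + 1) → ℝ} (hP : P ∈ cylinder I Ω)
include hseed hε hΩ hsol

theorem IsInflatedSolution.isWarpData : IsWarpData ε I Ω μ μ V h :=
  hseed.isWarpData hε hΩ hsol.isOpen hsol.smooth hsol.smooth

include hP

theorem IsInflatedSolution.pd_zero_inflatedField :
    pd 0 (inflatedField V σ ρ μ) P = ρ * deriv μ (P 0) :=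
  ((hsol.isWarpData hseed hε hΩ).pd_zero_field (contDiffOn_const.mul hsol.smooth) hP σ).trans
    ((hasDerivAt_of_contDiffOn hsol.isOpen hsol.smooth hP.1).const_mul ρ).deriv

theorem IsInflatedSolution.pd_succ_inflatedField (i : Fin n) :
    pd i.succ (inflatedField V σ ρ μ) P = σ * pd i V (Fin.tail P) :=
  (hsol.isWarpData hseed hε hΩ).pd_succ_field
    (contDiffOn_const.mul hsol.smooth : ContDiffOn ℝ ∞ (fun y => ρ * μ y) I) hP σ i

/-- Both blocks carry the same factor e^{2μ}, so it cancels in the gradient term. -/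
theorem IsInflatedSolution.equation_zero_zero :
    ε * Real.exp (2 * ((α + (α + δ)) * V (Fin.tail P))) * α *
      (((n - 2) * (α + δ) - α - (n - 3)) * gradSq h V (Fin.tail P))
      - n * deriv (deriv μ) (P 0) =
    κ * (ρ ^ 2 * deriv μ (P 0) ^ 2 + 2 / (n - 1) *
      (ε * Real.exp (2 * (μ (P 0) + α * V (Fin.tail P)))) * W (inflatedField V σ ρ μ P)) := by
  have he := hsol.solution.einstein P hP 0 0
  rw [hsol.pd_zero_inflatedField hseed hε hΩ hP, inflatedMetric_eq_warpMetric,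
    (hsol.isWarpData hseed hε hΩ).ricci_zero_zero hP, hseed.box_eq hε hΩ hP.2, warpMetric,
    blockMatrix_zero_zero] at he
  have hx : 2 * (μ (P 0) + α * V (Fin.tail P) - (μ (P 0) - (α + δ) * V (Fin.tail P))) =
      2 * ((α + (α + δ)) * V (Fin.tail P)) := by ring
  rw [hx] at he
  push_cast at he
  rw [show (n : ℝ) + 1 - 2 = n - 1 by ring] at he
  linear_combination he

theorem IsInflatedSolution.equation_zero_succ (i : Fin n) :
    (n - 1) * α * deriv μ (P 0) * pd i V (Fin.tail P) =
      κ * (ρ * deriv μ (P 0) * (σ * pd i V (Fin.tail P))) := by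
  have he := hsol.solution.einstein P hP 0 i.succ
  rw [hsol.pd_zero_inflatedField hseed hε hΩ hP, hsol.pd_succ_inflatedField hseed hε hΩ hP,
    inflatedMetric_eq_warpMetric, (hsol.isWarpData hseed hε hΩ).ricci_zero_succ hP, warpMetric,
    blockMatrix_zero_succ] at he
  linear_combination he

/-- The seed equations remove Ric and □V, leaving c∇∇V + t dV⊗dV = f h with constants c and t. Both
the exceptional condition and the rank argument come from this form. -/
theorem IsInflatedSolution.equation_succ_succ (i j : Fin n) :
    ((n - 2) * (α + δ) - α - (n - 3)) * hessian h V i j (Fin.tail P)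
      + ((n - 2) * (α + δ) ^ 2 - α ^ 2 - 2 * α * (α + δ) - (n - 5) - κ * σ ^ 2) *
        (pd i V (Fin.tail P) * pd j V (Fin.tail P)) =
    (((n - 2) * (α + δ) - α - (n - 3)) * ((α + δ) * gradSq h V (Fin.tail P))
      + Real.exp (2 * (μ (P 0) - (α + δ) * V (Fin.tail P))) *
        (ε * Real.exp (-(2 * (μ (P 0) + α * V (Fin.tail P)))) *
          (deriv (deriv μ) (P 0) + (n - 1) * deriv μ (P 0) ^ 2)
        + 2 * κ / (n - 1) * W (inflatedField V σ ρ μ P))) * h (Fin.tail P) i j := by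
  have he := hsol.solution.einstein P hP i.succ j.succ
  rw [hsol.pd_succ_inflatedField hseed hε hΩ hP, hsol.pd_succ_inflatedField hseed hε hΩ hP,
    inflatedMetric_eq_warpMetric, (hsol.isWarpData hseed hε hΩ).ricci_succ_succ hP,
    hseed.box_eq hε hΩ hP.2, hseed.ricci_eq hε hΩ hP.2, warpMetric, blockMatrix_succ_succ,
    Matrix.smul_apply, smul_eq_mul, ← exp_two_mul_mul_exp_neg] at he
  push_cast at he
  rw [show (n : ℝ) + 1 - 2 = n - 1 by ring] at he
  linear_combination he

end Equations

section Converse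

variable (hseed : IsVacuumSeed ε Ω V h) (hε : ε = 1 ∨ ε = -1) (hΩ : IsOpen Ω)
  (hΩc : IsConnected Ω) (hn : 4 ≤ n + 1) (hκ : 0 < κ)
  (hsol : IsInflatedSolution κ ε Ω V h I μ α δ σ ρ W)
include hseed hε hΩ hn hsol

/-- Outside the exceptional case, the exponent `δ` is determined by `α`. -/
theorem IsInflatedSolution.delta_eq (hV : ¬ IsExceptional Ω V h) : δ = delta (n + 1) α := by
  have hn3 : (3 : ℝ) ≤ n := by exact_mod_cast (by omega : 3 ≤ n)
  by_contra hδ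
  have hc : (n - 2) * (α + δ) - α - (n - 3) ≠ 0 := by
    intro hc
    refine hδ ?_
    have : (n : ℝ) - 2 ≠ 0 := by linarith
    rw [delta]
    push_cast
    rw [show (n : ℝ) + 1 - 4 = n - 3 by ring, show (n : ℝ) + 1 - 3 = n - 2 by ring]
    field_simp
    linarith
  -- Only some value of y in I is needed: freezing it turns f/c into a function b of x alone.
  obtain ⟨P₀, hP₀, -⟩ := hsol.potential
  refine hV ⟨-((n - 2) * (α + δ) ^ 2 - α ^ 2 - 2 * α * (α + δ) - (n - 5) - κ * σ ^ 2) /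
    ((n - 2) * (α + δ) - α - (n - 3)),
    fun x => (((n - 2) * (α + δ) - α - (n - 3)) * ((α + δ) * gradSq h V x)
      + Real.exp (2 * (μ (P₀ 0) - (α + δ) * V x)) *
        (ε * Real.exp (-(2 * (μ (P₀ 0) + α * V x))) *
          (deriv (deriv μ) (P₀ 0) + (n - 1) * deriv μ (P₀ 0) ^ 2)
        + 2 * κ / (n - 1) * W (inflatedField V σ ρ μ (Fin.cons (P₀ 0) x)))) /
      ((n - 2) * (α + δ) - α - (n - 3)), fun x hx i j => ?_⟩
  have he := hsol.equation_succ_succ hseed hε hΩ (P := Fin.cons (P₀ 0) x)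
    ⟨hP₀.1, by simpa⟩ i j
  simp only [Fin.tail_cons, Fin.cons_zero] at he
  have hE : ∀ {c H t b A B : ℝ}, c ≠ 0 → c * H + t * A = b * B → H = -t / c * A + b / c * B := by
    intro c H t b A B hc he
    field_simp
    linarith
  rw [mul_assoc]
  exact hE hc he

include hΩc hκ

/-- The field equations of an inflated solution with Fonarev exponents. -/
theorem IsInflatedSolution.friedmann
    (hred : (∀ x ∈ Ω, V x = 0) ∨ (¬ ∃ c, ∀ x ∈ Ω, V x = c) ∧ δ = delta (n + 1) α)
    {k lam : ℝ} (hk : k = √(κ / (((n + 1 : ℕ) : ℝ) - 2))) (hlam : lam = ρ * k) :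
    (∀ y ∈ I, deriv (deriv μ) y = (1 - lam ^ 2) * deriv μ y ^ 2) ∧
    (∀ P ∈ cylinder I Ω, W (inflatedField V σ ρ μ P) = -ε * ((n - 1) / (2 * κ)) * (n - lam ^ 2) *
      (deriv μ (P 0) ^ 2 * Real.exp (-(2 * (μ (P 0) + α * V (Fin.tail P)))))) ∧
    ∃ s : ℝ, (s = 1 ∨ s = -1) ∧ ∀ x ∈ Ω, alpha (n + 1) lam s * V x = α * V x ∧
      gamma (n + 1) lam s * V x = (α + δ) * V x ∧
      s * (1 / √(((n + 1 : ℕ) : ℝ) - 3 + lam ^ 2)) * V x = σ * k * V x := by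
  have w := hsol.isWarpData hseed hε hΩ
  have hn3 : (3 : ℝ) ≤ n := by exact_mod_cast (by omega : 3 ≤ n)
  have hn1 : (n : ℝ) - 1 ≠ 0 := by linarith
  have hn2 : (n : ℝ) - 2 ≠ 0 := by linarith
  have hksq : k ^ 2 * (n - 1) = κ := by
    have : (0 : ℝ) ≤ κ / (((n + 1 : ℕ) : ℝ) - 2) :=
      div_nonneg hκ.le (by push_cast; linarith)
    rw [hk, Real.sq_sqrt this]
    push_cast
    rw [show (n : ℝ) + 1 - 2 = n - 1 by ring]
    field_simp
  have hc : (n - 2) * delta (n + 1) α = (n - 3) * (1 - α) := by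
    rw [delta]
    push_cast
    rw [show (n : ℝ) + 1 - 4 = n - 3 by ring, show (n : ℝ) + 1 - 3 = n - 2 by ring]
    field_simp
  -- Either V ≡ 0 and the terms multiplied by c vanish, or c itself vanishes by the value of δ.
  have hcS : ∀ x ∈ Ω, ((n - 2) * (α + δ) - α - (n - 3)) * gradSq h V x = 0 := by
    intro x hx
    rcases hred with hV | ⟨-, rfl⟩
    · rw [gradSq_eq_zero_of_eq_zero hΩ hV h hx, mul_zero]
    · linear_combination gradSq h V x * hc
  have hcH : ∀ x ∈ Ω, ∀ i j, ((n - 2) * (α + δ) - α - (n - 3)) * hessian h V i j x = 0 := by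
    intro x hx i j
    rcases hred with hV | ⟨-, rfl⟩
    · rw [hessian_eq_zero_of_eq_zero hΩ hV h i j hx, mul_zero]
    · linear_combination hessian h V i j x * hc
  have hij : ∀ P ∈ cylinder I Ω, ∀ i j,
      ((n - 2) * (α + δ) ^ 2 - α ^ 2 - 2 * α * (α + δ) - (n - 5) - κ * σ ^ 2) *
        (pd i V (Fin.tail P) * pd j V (Fin.tail P)) =
      Real.exp (2 * (μ (P 0) - (α + δ) * V (Fin.tail P))) *
        (ε * Real.exp (-(2 * (μ (P 0) + α * V (Fin.tail P)))) *
          (deriv (deriv μ) (P 0) + (n - 1) * deriv μ (P 0) ^ 2)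
        + 2 * κ / (n - 1) * W (inflatedField V σ ρ μ P)) * h (Fin.tail P) i j := by
    intro P hP i j
    linear_combination hsol.equation_succ_succ hseed hε hΩ hP i j - hcH _ hP.2 i j
      + (α + δ) * h (Fin.tail P) i j * hcS _ hP.2
  have hW0 : ∀ P ∈ cylinder I Ω, ε * Real.exp (-(2 * (μ (P 0) + α * V (Fin.tail P)))) *
      (deriv (deriv μ) (P 0) + (n - 1) * deriv μ (P 0) ^ 2)
        + 2 * κ / (n - 1) * W (inflatedField V σ ρ μ P) = 0 := by
    intro P hP
    -- The rank argument: the metric is nondegenerate in dimension at least 2 and cannot be a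
    -- multiple of dV⊗dV.
    have := eq_zero_of_mul_eq_mul (by omega) (hseed.metric.nondegenerate _ hP.2) (hij P hP)
    exact (mul_eq_zero.1 this).resolve_left (Real.exp_ne_zero _)
  obtain ⟨x₀, hx₀⟩ := hΩc.nonempty
  have hμ2 : ∀ y ∈ I, deriv (deriv μ) y = (1 - lam ^ 2) * deriv μ y ^ 2 := by
    intro y hy
    have hP : (Fin.cons y x₀ : Fin (n + 1) → ℝ) ∈ cylinder I Ω := ⟨hy, by simpa⟩
    have h1 := hW0 _ hP
    have h2 := hsol.equation_zero_zero hseed hε hΩ hP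
    have hS := hcS x₀ hx₀
    simp only [Fin.tail_cons, Fin.cons_zero] at h1 h2
    rw [hS] at h2
    have hE : Real.exp (2 * (μ y + α * V x₀)) * Real.exp (-(2 * (μ y + α * V x₀))) = 1 := by
      rw [← Real.exp_add]; simp
    generalize Real.exp (2 * (μ y + α * V x₀)) = E at *
    generalize Real.exp (-(2 * (μ y + α * V x₀))) = E' at *
    generalize W (inflatedField V σ ρ μ (Fin.cons y x₀)) = w₀ at *
    refine mul_left_cancel₀ hn1 ?_
    rw [hlam]
    -- Eliminates W between the yy equation and f = 0; κρ² = (n-1)λ² then gives the factor 1-λ².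
    linear_combination -h2 - ε * E * h1
      + (ε * ε * (deriv (deriv μ) y + (n - 1) * deriv μ y ^ 2)) * hE
      + (deriv (deriv μ) y + (n - 1) * deriv μ y ^ 2) * w.sq_eps
      + ρ ^ 2 * deriv μ y ^ 2 * hksq
  refine ⟨hμ2, fun P hP => ?_, ?_⟩
  · have h1 := hW0 P hP
    rw [hμ2 _ hP.1] at h1
    generalize W (inflatedField V σ ρ μ P) = w₀ at *
    have h2 : w₀ = (n - 1) / (2 * κ) * (2 * κ / (n - 1) * w₀) := by field_simp
    rw [h2]
    linear_combination ((n - 1) / (2 * κ)) * h1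
  · rcases hred with hV | ⟨hV, rfl⟩
    -- For V ≡ 0 the sign has no effect, and either choice would do.
    · exact ⟨1, Or.inl rfl, fun x hx => by simp [hV x hx]⟩
    · obtain ⟨x, hx, i, hi⟩ := exists_pd_ne_zero hΩ hΩc.isPreconnected hseed.smooth hV
      obtain ⟨y, hy, hy0⟩ : ∃ y ∈ I, deriv μ y ≠ 0 := by
        by_contra! hcon
        exact hsol.nonconstant (const_of_deriv_eq_zero hsol.isOpen hsol.interval hsol.smooth hcon)
      have hP : (Fin.cons y x : Fin (n + 1) → ℝ) ∈ cylinder I Ω := ⟨hy, by simpa⟩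
      have h1 := hij _ hP i i
      rw [hW0 _ hP] at h1
      have h2 := hsol.equation_zero_succ hseed hε hΩ hP i
      simp only [Fin.tail_cons, Fin.cons_zero] at h1 h2
      -- The mixed equation, at a point where neither μ' nor ∂_i V vanishes.
      have h3 : (n - 1) * α = κ * ρ * σ := by
        refine mul_right_cancel₀ (mul_ne_zero hy0 hi) ?_
        linear_combination h2
      have h4 : (n - 2) * (α + delta (n + 1) α) ^ 2 - α ^ 2 - 2 * α * (α + delta (n + 1) α)
          - (n - 5) - κ * σ ^ 2 = 0 := by
        refine mul_right_cancel₀ (mul_ne_zero hi hi) ?_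
        linear_combination h1
      have h5 : lam * (σ * k) = α := by
        refine mul_left_cancel₀ hn1 ?_
        rw [hlam]
        linear_combination ρ * σ * hksq - h3
      -- The condition t = 0, with δ eliminated by c = 0, says 1-α² = (n-2)(σk)²; inserting α = λσk
      -- gives this normalization.
      have h6 : (σ * k) ^ 2 * (((n + 1 : ℕ) : ℝ) - 3 + lam ^ 2) = 1 := by
        push_cast
        have h7 : (n - 2) * (α + delta (n + 1) α) = α + (n - 3) := by linear_combination hc
        have h8 : (n - 1) * (1 - α ^ 2) = (n - 1) * ((n - 2) * (σ * k) ^ 2) := by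
          linear_combination (n - 2) * h4 - ((n - 2) * (α + delta (n + 1) α) - 2 * α
            + (α + (n - 3))) * h7 - (n - 2) * σ ^ 2 * hksq
        have h9 := mul_left_cancel₀ hn1 h8
        rw [← h5] at h9
        linear_combination -h9
      have hR := radicand_pos hn (lam := lam)
      have hL := Real.sqrt_pos.2 hR
      -- The sign s is σk√(N-3+λ²), whose square is 1 by `h6`.
      have hs : (σ * k * √(((n + 1 : ℕ) : ℝ) - 3 + lam ^ 2)) ^ 2 = 1 := by
        rw [mul_pow, Real.sq_sqrt hR.le, h6]
      have hα : alpha (n + 1) lam (σ * k * √(((n + 1 : ℕ) : ℝ) - 3 + lam ^ 2)) = α := by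
        rw [alpha, ← h5]
        field_simp
      refine ⟨_, mul_self_eq_one_iff.1 ((sq _).symm.trans hs), fun x hx => ⟨?_, ?_, ?_⟩⟩
      · rw [hα]
      · rw [gamma, hα]
      · field_simp

end Converse

end

/-! ### Uniqueness of the parameters and existence of the coordinate -/

section

variable {n : ℕ} {ε κ : ℝ} {Ω : Set (Fin n → ℝ)} {V : (Fin n → ℝ) → ℝ}
  {h : (Fin n → ℝ) → Matrix (Fin n) (Fin n) ℝ} {I : Set ℝ} {μ : ℝ → ℝ} {α δ σ ρ : ℝ} {W : ℝ → ℝ}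

variable (hseed : IsVacuumSeed ε Ω V h) (hε : ε = 1 ∨ ε = -1) (hΩ : IsOpen Ω)
  (hΩc : IsConnected Ω) (hn : 4 ≤ n + 1) (hκ : 0 < κ)
  (hsol : IsInflatedSolution κ ε Ω V h I μ α δ σ ρ W)
  {k : ℝ} (hk : k = √(κ / (((n + 1 : ℕ) : ℝ) - 2)))
include hseed hε hΩc hn hκ hsol hk

/-- An inflated solution determines the parameters `λ` and `η` of a Fonarev solution
that it is equivalent to. -/
theorem IsInflatedSolution.parameters_eq
    (hV : (∀ x ∈ Ω, V x = 0) ∨ ¬ ∃ c, ∀ x ∈ Ω, V x = c) {lam η s : ℝ} {Y : ℝ → ℝ} (hη : 0 < η)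
    (hF : IsFonarevIn (n + 1) κ ε Ω V h I (inflatedMetric ε V h α δ μ) (inflatedField V σ ρ μ) W
      lam η s Y) :
    lam = ρ * k ∧ ∀ y ∈ I, η * Real.exp (2 * ((1 - lam ^ 2) * μ y)) = deriv μ y ^ 2 := by
  have hn3 : (3 : ℝ) ≤ n := by exact_mod_cast (by omega : 3 ≤ n)
  have hε0 : ε ≠ 0 := by rcases hε with rfl | rfl <;> norm_num
  have hkm : k * √((((n + 1 : ℕ) : ℝ) - 2) / κ) = 1 := by
    rw [hk]
    exact sqrt_div_mul_sqrt_div hκ (by push_cast; linarith)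
  have hη' := Real.sqrt_pos.2 hη
  have hYd : ∀ y ∈ I, HasDerivAt Y (deriv Y y) y := fun y hy =>
    hasDerivAt_of_contDiffOn hsol.isOpen hF.coordChange.smooth hy
  have hmet : ∀ y ∈ I, ∀ x ∈ Ω,
      Real.exp (2 * (μ y + α * V x)) = deriv Y y ^ 2 *
        Real.exp (2 * (lam ^ 2 * √η * Y y + alpha (n + 1) lam s * V x)) ∧
      μ y - (α + δ) * V x = √η * Y y - gamma (n + 1) lam s * V x := by
    intro y hy x hx
    have hP : (Fin.cons y x : Fin (n + 1) → ℝ) ∈ cylinder I Ω := ⟨hy, by simpa⟩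
    have hm := hF.metric _ hP
    rw [inflatedMetric_eq_warpMetric, fonarevMetric_eq_warpMetric,
      pullback_warpMetric (hYd _ hP.1), warpMetric] at hm
    simp only [Fin.tail_cons, Fin.cons_zero] at hm
    constructor
    · have := congrFun (congrFun hm 0) 0
      simp only [blockMatrix_zero_zero] at this
      refine mul_left_cancel₀ hε0 ?_
      linear_combination this
    · obtain ⟨i, j, hij⟩ := exists_apply_ne_zero (by omega) (hseed.metric.nondegenerate x hx)
      have := congrFun (congrFun hm i.succ) j.succ
      simp only [blockMatrix_succ_succ, Matrix.smul_apply, smul_eq_mul] at this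
      have := Real.exp_injective (mul_right_cancel₀ hij this)
      linarith
  have hfield : ∀ y ∈ I, ∀ x ∈ Ω, σ * V x + ρ * μ y = √((((n + 1 : ℕ) : ℝ) - 2) / κ) *
      (s * (1 / √(((n + 1 : ℕ) : ℝ) - 3 + lam ^ 2)) * V x + lam * √η * Y y) := by
    intro y hy x hx
    have hP : (Fin.cons y x : Fin (n + 1) → ℝ) ∈ cylinder I Ω := ⟨hy, by simpa⟩
    have := hF.field _ hP
    simpa [inflatedField, fonarevField, changeY] using this
  obtain ⟨x₀, hx₀⟩ := hΩc.nonempty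
  -- At fixed x the spatial metric gives equal increments of μ and √η Y. The field then relates ρ
  -- and λ, since μ is not constant.
  have hlam : lam = ρ * k := by
    by_contra hne
    obtain ⟨P, hP, -⟩ := hsol.potential
    refine hsol.nonconstant ⟨μ (P 0), fun y hy => ?_⟩
    have h1 := (hmet y hy x₀ hx₀).2
    have h2 := (hmet _ hP.1 x₀ hx₀).2
    have h3 := hfield y hy x₀ hx₀
    have h4 := hfield _ hP.1 x₀ hx₀
    have h5 : (lam - ρ * k) * (μ y - μ (P 0)) = 0 := by
      linear_combination lam * (h1 - h2) - k * (h3 - h4) - (lam * √η * (Y y - Y (P 0))) * hkm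
    exact sub_eq_zero.1 ((mul_eq_zero.1 h5).resolve_left (sub_ne_zero.2 hne))
  -- For V ≡ 0 there is nothing to compare; otherwise two points with different values of V, at the
  -- same y, determine the exponents.
  have hαγ : ∀ x ∈ Ω, gamma (n + 1) lam s * V x = (α + δ) * V x ∧
      alpha (n + 1) lam s * V x = α * V x := by
    rcases hV with hV | hV
    · exact fun x hx => by simp [hV x hx]
    · obtain ⟨P, hP, -⟩ := hsol.potential
      have hx₁ : ∃ x₁ ∈ Ω, V x₁ - V x₀ ≠ 0 := by
        by_contra! hcon
        exact hV ⟨V x₀, fun x hx => sub_eq_zero.1 (hcon x hx)⟩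
      obtain ⟨x₁, hx₁, hne⟩ := hx₁
      have h0 := hmet _ hP.1 x₀ hx₀
      have h1 := hmet _ hP.1 x₁ hx₁
      have hγ : gamma (n + 1) lam s = α + δ := by
        refine mul_right_cancel₀ hne ?_
        linear_combination h1.2 - h0.2
      have hα : alpha (n + 1) lam s = α := by
        have h2 := h1.1
        have h3 : ∀ a b c : ℝ, Real.exp (2 * (a + b)) = Real.exp (2 * (a + c)) *
            Real.exp (2 * (b - c)) := fun a b c => by rw [← Real.exp_add]; congr 1; ring
        rw [h3 _ _ (α * V x₀), h3 _ (alpha (n + 1) lam s * V x₁)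
          (alpha (n + 1) lam s * V x₀), ← mul_assoc, ← h0.1] at h2
        have h4 := Real.exp_injective (mul_left_cancel₀ (Real.exp_ne_zero _) h2)
        refine mul_right_cancel₀ hne ?_
        linear_combination -h4 / 2
      exact fun x _ => by rw [hγ, hα]; exact ⟨rfl, rfl⟩
  -- No additive constant remains, so Y cannot be translated; a translation would in general rescale
  -- η.
  have hYμ : ∀ y ∈ I, √η * Y y = μ y := fun y hy => by
    linear_combination -(hmet y hy x₀ hx₀).2 + (hαγ x₀ hx₀).1
  refine ⟨hlam, fun y hy => ?_⟩
  have hd : deriv μ y = √η * deriv Y y := by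
    have : μ =ᶠ[nhds y] fun z => √η * Y z := by
      filter_upwards [hsol.isOpen.mem_nhds hy] with z hz using (hYμ z hz).symm
    rw [this.deriv_eq]
    exact ((hYd y hy).const_mul _).deriv
  have h1 := (hmet y hy x₀ hx₀).1
  rw [(hαγ x₀ hx₀).2, mul_assoc, hYμ y hy] at h1
  have h2 : Real.exp (2 * (μ y + α * V x₀)) = Real.exp (2 * ((1 - lam ^ 2) * μ y)) *
      Real.exp (2 * (lam ^ 2 * μ y + α * V x₀)) := by
    rw [← Real.exp_add]; congr 1; ring
  rw [h2] at h1
  rw [hd, mul_pow, Real.sq_sqrt hη.le, mul_right_cancel₀ (Real.exp_ne_zero _) h1]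

include hΩ

/-- An inflated solution with Fonarev exponents is equivalent to a Fonarev solution. -/
theorem IsInflatedSolution.exists_isFonarevIn
    (hred : (∀ x ∈ Ω, V x = 0) ∨ (¬ ∃ c, ∀ x ∈ Ω, V x = c) ∧ δ = delta (n + 1) α) :
    ∃ η : ℝ, 0 < η ∧ (ρ * k) ^ 2 ≠ ((n + 1 : ℕ) : ℝ) - 1 ∧ ∃ (s : ℝ) (Y : ℝ → ℝ),
      (s = 1 ∨ s = -1) ∧ IsFonarevIn (n + 1) κ ε Ω V h I (inflatedMetric ε V h α δ μ)
        (inflatedField V σ ρ μ) W (ρ * k) η s Y := by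
  have hn3 : (3 : ℝ) ≤ n := by exact_mod_cast (by omega : 3 ≤ n)
  have hkm : √((((n + 1 : ℕ) : ℝ) - 2) / κ) * k = 1 := by
    rw [hk, mul_comm]
    exact sqrt_div_mul_sqrt_div hκ (by push_cast; linarith)
  obtain ⟨hμ2, hW, s, hs, hx⟩ :=
    hsol.friedmann hseed hε hΩ hΩc hn hκ hred hk (lam := ρ * k) rfl
  set lam := ρ * k
  -- The integration constant supplies η = C². Then √η Y = μ matches the spatial factor, and Y'² =
  -- e^{2(1-λ²)μ} matches the dy² factor.
  obtain ⟨C, hC⟩ := exists_deriv_eq_mul_exp hsol.isOpen hsol.interval hsol.smooth hμ2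
  have hC0 : C ≠ 0 := by
    rintro rfl
    exact hsol.nonconstant (const_of_deriv_eq_zero hsol.isOpen hsol.interval hsol.smooth
      fun y hy => by rw [hC y hy, zero_mul])
  have hη : 0 < C ^ 2 := by positivity
  have hη' := Real.sqrt_pos.2 hη
  have hηs := Real.sq_sqrt hη.le
  have hηne := hη'.ne'
  have hYd : ∀ y ∈ I, HasDerivAt (fun y => (√(C ^ 2))⁻¹ * μ y)
      ((√(C ^ 2))⁻¹ * (C * Real.exp ((1 - lam ^ 2) * μ y))) y := fun y hy => by
    rw [← hC y hy]
    exact (hasDerivAt_of_contDiffOn hsol.isOpen hsol.smooth hy).const_mul _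
  have hexp : ∀ y, Real.exp ((1 - lam ^ 2) * μ y) ^ 2 = Real.exp (2 * ((1 - lam ^ 2) * μ y)) :=
    fun y => by rw [← Real.exp_nat_mul]; norm_num
  refine ⟨C ^ 2, hη, ?_, s, fun y => (√(C ^ 2))⁻¹ * μ y, hs, ⟨contDiffOn_const.mul hsol.smooth,
    fun y hy => ?_, ?_⟩, fun P hP => ?_, fun P hP => ?_, fun P hP => ?_⟩
  -- For λ² = N-1 the formula for W vanishes identically, which the class excludes.
  · intro hcon
    obtain ⟨P, hP, hne⟩ := hsol.potential
    refine hne ?_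
    rw [hW P hP, hcon]
    push_cast
    ring
  · rw [(hYd y hy).deriv]
    have := Real.exp_ne_zero ((1 - lam ^ 2) * μ y)
    positivity
  -- The factor C settles the sign: (Cμ)' = C² e^{(1-λ²)μ} > 0.
  · have hmono : StrictMonoOn (fun y => C * μ y) I := by
      refine strictMonoOn_of_deriv_pos hsol.interval.convex
        (contDiffOn_const.mul hsol.smooth).continuousOn fun y hy => ?_
      have hy' := interior_subset hy
      rw [((hasDerivAt_of_contDiffOn hsol.isOpen hsol.smooth hy').const_mul C).deriv, hC y hy',
        ← mul_assoc, ← sq]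
      positivity
    intro y hy z hz hyz
    refine hmono.injOn hy hz ?_
    have := mul_left_cancel₀ (inv_ne_zero hηne) hyz
    exact congrArg (C * ·) this
  · have hx' := hx _ hP.2
    rw [inflatedMetric_eq_warpMetric, fonarevMetric_eq_warpMetric,
      pullback_warpMetric (hYd _ hP.1), warpMetric, hx'.1, hx'.2.1, mul_assoc,
      mul_inv_cancel_left₀ hηne, mul_left_comm, mul_pow, inv_pow, hηs, mul_pow, hexp,
      inv_mul_cancel_left₀ hη.ne', ← Real.exp_add]
    congr 3
    ring
  · have hx' := (hx _ hP.2).2.2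
    simp only [inflatedField, fonarevField, changeY, Fin.tail_cons, Fin.cons_zero]
    rw [hx', mul_assoc lam, mul_inv_cancel_left₀ hηne]
    linear_combination -(σ * V (Fin.tail P) + ρ * μ (P 0)) * hkm
  · have hx' := hx _ hP.2
    rw [hW P hP, fonarevPotential, fonarevW0, ← hk, hC _ hP.1, mul_pow C, hexp]
    have hα : k * lam * (σ * V (Fin.tail P)) = α * V (Fin.tail P) := by
      rw [← hx'.1, alpha]
      linear_combination -lam * hx'.2.2
    have he : -2 * (k * lam) * inflatedField V σ ρ μ P = 2 * ((1 - lam ^ 2) * μ (P 0))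
        + -(2 * (μ (P 0) + α * V (Fin.tail P))) := by
      rw [inflatedField, ← hα]
      ring
    rw [he, Real.exp_add]
    push_cast
    ring

theorem IsInflatedSolution.existsUnique_isFonarevIn
    (hcases : (∀ x ∈ Ω, V x = 0) ∨ ¬ IsExceptional Ω V h ∨
      ((¬ ∃ c, ∀ x ∈ Ω, V x = c) ∧ δ = delta (n + 1) α)) :
    ∃! p : ℝ × ℝ, 0 < p.2 ∧ p.1 ^ 2 ≠ ((n + 1 : ℕ) : ℝ) - 1 ∧ ∃ (s : ℝ) (Y : ℝ → ℝ),
      (s = 1 ∨ s = -1) ∧ IsFonarevIn (n + 1) κ ε Ω V h I (inflatedMetric ε V h α δ μ)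
        (inflatedField V σ ρ μ) W p.1 p.2 s Y := by
  have hred : (∀ x ∈ Ω, V x = 0) ∨ (¬ ∃ c, ∀ x ∈ Ω, V x = c) ∧ δ = delta (n + 1) α := by
    rcases hcases with hV | hV | hV
    · exact Or.inl hV
    · refine Or.inr ⟨?_, hsol.delta_eq hseed hε hΩ hn hV⟩
      -- A constant V is exceptional, with a = 0 and b = 0.
      rintro ⟨c, hc⟩
      have hpd : ∀ i, ∀ x ∈ Ω, pd i V x = 0 := fun i x hx => by
        have : V =ᶠ[nhds x] fun _ => c := by
          filter_upwards [hΩ.mem_nhds hx] with y hy using hc y hy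
        rw [pd, this.fderiv_eq]
        simp
      refine hV ⟨0, 0, fun x hx i j => ?_⟩
      rw [hessian, pd_eq_zero_of_eq_zero hΩ (hpd j) i hx]
      simp [hpd _ x hx]
    · exact Or.inr hV
  have hV : (∀ x ∈ Ω, V x = 0) ∨ ¬ ∃ c, ∀ x ∈ Ω, V x = c := hred.imp_right And.left
  obtain ⟨η, hη, hne, s, Y, hs, hF⟩ :=
    hsol.exists_isFonarevIn hseed hε hΩ hΩc hn hκ hk hred
  refine ⟨(ρ * k, η), ⟨hη, hne, s, Y, hs, hF⟩, ?_⟩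
  rintro ⟨lam', η'⟩ ⟨hη', -, s', Y', -, hF'⟩
  obtain ⟨P, hP, -⟩ := hsol.potential
  obtain ⟨h1, h2⟩ := hsol.parameters_eq hseed hε hΩc hn hκ hk hV hη hF
  obtain ⟨h1', h2'⟩ := hsol.parameters_eq hseed hε hΩc hn hκ hk hV hη' hF'
  dsimp only at h1' h2'
  subst h1'
  -- Once λ agrees, both η satisfy the same relation with μ'² at one point.
  have := (h2' _ hP.1).trans (h2 _ hP.1).symm
  rw [mul_right_cancel₀ (Real.exp_ne_zero _) this]

end

end Fonarev

theorem corollary4 (N n : ℕ) (hN : N = n + 1) (hN4 : 4 ≤ N) (κ ε : ℝ) (hκ : 0 < κ)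
    (hε : ε = 1 ∨ ε = -1) (Ω : Set (Fin n → ℝ)) (hΩ : IsOpen Ω) (hΩc : IsConnected Ω)
    (V : (Fin n → ℝ) → ℝ) (hhat : (Fin n → ℝ) → Matrix (Fin n) (Fin n) ℝ)
    (hseed : Fonarev.IsVacuumSeed ε Ω V hhat) :
    -- every member of the family is a solution, and belongs to the class if `W₀ ≠ 0`
    (∀ lam η s : ℝ, 0 < η → (s = 1 ∨ s = -1) →
      Fonarev.IsEinsteinScalarSolution κ (Fonarev.cylinder Set.univ Ω)
        (Fonarev.fonarevMetric N ε V hhat lam η s) (Fonarev.fonarevField N κ V lam η s)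
        (Fonarev.fonarevPotential N κ ε lam η) ∧
      (Fonarev.fonarevW0 N κ ε lam η ≠ 0 ↔ lam ^ 2 ≠ (N : ℝ) - 1) ∧
      (lam ^ 2 ≠ (N : ℝ) - 1 →
        ∃ (I : Set ℝ) (μ : ℝ → ℝ) (α δ σ ρ : ℝ) (Y : ℝ → ℝ),
          α = Fonarev.alpha N lam s ∧ δ = Fonarev.delta N α ∧
          Fonarev.IsInflatedSolution κ ε Ω V hhat I μ α δ σ ρ
            (Fonarev.fonarevPotential N κ ε lam η) ∧
          Y '' I = Set.univ ∧
          Fonarev.IsFonarevIn N κ ε Ω V hhat I (Fonarev.inflatedMetric ε V hhat α δ μ)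
            (Fonarev.inflatedField V σ ρ μ) (Fonarev.fonarevPotential N κ ε lam η)
            lam η s Y)) ∧
    -- every solution of the class is a member of the family, for a unique pair `(λ, η)`
    (∀ (I : Set ℝ) (μ : ℝ → ℝ) (α δ σ ρ : ℝ) (W : ℝ → ℝ),
      Fonarev.IsInflatedSolution κ ε Ω V hhat I μ α δ σ ρ W →
      ((∀ x ∈ Ω, V x = 0) ∨ ¬ Fonarev.IsExceptional Ω V hhat ∨
        ((¬ ∃ c, ∀ x ∈ Ω, V x = c) ∧ δ = Fonarev.delta N α)) →
      ∃! P : ℝ × ℝ, 0 < P.2 ∧ P.1 ^ 2 ≠ (N : ℝ) - 1 ∧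
        ∃ (s : ℝ) (Y : ℝ → ℝ), (s = 1 ∨ s = -1) ∧
          Fonarev.IsFonarevIn N κ ε Ω V hhat I (Fonarev.inflatedMetric ε V hhat α δ μ)
            (Fonarev.inflatedField V σ ρ μ) W P.1 P.2 s Y) := by
  subst hN
  refine ⟨fun lam η s hη hs => ⟨?_, Fonarev.fonarevW0_ne_zero_iff hε hN4 hκ hη, fun hlam => ?_⟩,
    fun I μ α δ σ ρ W hsol hcases => ?_⟩
  · exact hseed.fonarev_isSolution hε hΩ hN4 hκ hη hs
  · exact hseed.fonarev_mem_class hε hΩ hN4 hκ hη hs hΩc.nonempty hlam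
  · exact hsol.existsUnique_isFonarevIn hseed hε hΩ hΩc hN4 hκ rfl hcases
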